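/- **Conventions.** Graphs are finite, simple and undirected; an $n$-vertex graph has vertex set $\{1,\dots,n\}$. Fix $d\in\mathbb N$; a graph is *$d$-bounded* if all its degrees are at most $d$. The *spectrum* $\Lambda_G\in[0,2]^n$ of an $n$-vertex graph $G$ is the sorted vector of eigenvalues (with multiplicity) of its normalized Laplacian $D^{-1/2}(D-A)D^{-1/2}$, where $A$ is the adjacency matrix, $D$ the diagonal degree matrix, and the entry of $D^{-1/2}$ at an isolated vertex is $0$ (so this is $I-D^{-1/2}AD^{-1/2}$ if there are no isolated vertices). A *graph property* is a class of graphs closed under isomorphism; $\Pi_n$ denotes the set of $n$-vertex graphs in $\Pi$. **Robustly spectral properties.** For $\delta>0$, a property $\Pi$ of $d$-bounded graphs is *$\delta$-robustly spectral* if for every $n$ there is a set $S_n$ of spectra of $d$-bounded $n$-vertex graphs such that $\Pi_n$ is the set of all $d$-bounded $n$-vertex graphs $G$ for which there is $x\in S_n$ with $\|\Lambda_G-x\|_1\le\delta n$. **High girth.** An isomorphism-closed class $\mathfrak G$ of graphs has *high girth* if there is $f:\mathbb N\to\mathbb N$ with $f(n)\to\infty$ such that every $n$-vertex graph in $\mathfrak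 G$ has girth at least $f(n)$ (forests have girth $\infty$). **Testing.** A $d$-bounded $n$-vertex graph $G$ is *$\epsilon$-far* from $\Pi$ if more than $\epsilon d n$ edges have to be inserted or deleted to turn $G$ into a $d$-bounded graph in $\Pi_n$ (in particular, if $\Pi_n=\emptyset$). In the bounded-degree graph model an algorithm knows $n$ and accesses the input graph, given by adjacency lists in arbitrary order, through adaptive queries "what is the $i$-th neighbour of $v$?" ($1\le i\le d$), answered by a special symbol if $v$ has fewer than $i$ neighbours. **Theorem.** Let $d\in\mathbb N$, let $\mathfrak G$ be a class of graphs of high girth, let $\delta>0$, and let $\Pi$ be a $\delta$-robustly spectral property of $d$-bounded graphs. Then $\Pi$ is testable in the bounded-degree graph model with degree bound $d$ when the input is restricted to $\mathfrak G$. That is, there is a function $q(\epsilon)$, not depending on $n$, such that for every $\epsilon>0$ and every $n\in\mathbb N$ there is a randomized algorithm which makes at most $q(\epsilon)$ queries and which, for every $d$-bounded $n$-vertex input graph $G\in\mathfrak G$, * accepts with probability at least $2/3$ if $G\in\Pi$, and * rejects with probability at least $2/3$ if $G$ is $\epsilon$-far from $\Pi$. -/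

import Mathlib

noncomputable section

namespace SpectralTesting

open scoped ENNReal

/-- A class of finite graphs closed under isomorphism, i.e. a graph property. The members with
exactly `n` vertices are given as graphs on the vertex set `Fin n`. -/
structure GraphClass where
  graphs : ∀ n : ℕ, Set (SimpleGraph (Fin n))
  iso_closed : ∀ (n : ℕ) (G H : SimpleGraph (Fin n)),
    Nonempty (G ≃g H) → G ∈ graphs n → H ∈ graphs n

/-- The class of all finite graphs. -/
def allGraphs : GraphClass where
  graphs _ := Set.univ
  iso_closed _ _ _ _ _ := Set.mem_univ _

/-- A class has high girth if, for some `f` tending to infinity, each of its `n`-vertex members has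
girth at least `f n`. (`egirth` is the length of a shortest cycle, and `⊤` for forests.) -/
def GraphClass.HighGirth (𝔊 : GraphClass) : Prop :=
  ∃ f : ℕ → ℕ, Filter.Tendsto f Filter.atTop Filter.atTop ∧
    ∀ (n : ℕ) (G : SimpleGraph (Fin n)), G ∈ 𝔊.graphs n → (f n : ℕ∞) ≤ G.egirth

open scoped Classical in
/-- The graph `G` has maximum degree at most `d`. -/
def DegreeBounded {n : ℕ} (d : ℕ) (G : SimpleGraph (Fin n)) : Prop :=
  ∀ v, G.degree v ≤ d

/-! ### Spectra -/

open scoped Classical in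
/-- The normalized Laplacian `D^{-1/2} (D - A) D^{-1/2}`, where the entry of `D^{-1/2}` at an
isolated vertex is `0`. This is `I - D^{-1/2} A D^{-1/2}` when there are no isolated vertices; the
row and column of an isolated vertex are zero, so that the multiplicity of the eigenvalue `0` is
always the number of connected components. -/
def normLaplacian {n : ℕ} (G : SimpleGraph (Fin n)) : Matrix (Fin n) (Fin n) ℝ :=
  Matrix.diagonal (fun v => (√(G.degree v : ℝ))⁻¹) * G.lapMatrix ℝ *
    Matrix.diagonal (fun v => (√(G.degree v : ℝ))⁻¹)

theorem normLaplacian_isHermitian {n : ℕ} (G : SimpleGraph (Fin n)) :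
    (normLaplacian G).IsHermitian := by
  classical
  unfold normLaplacian
  rw [Matrix.IsHermitian, Matrix.conjTranspose_mul, Matrix.conjTranspose_mul,
    Matrix.diagonal_conjTranspose, Matrix.conjTranspose_eq_transpose_of_trivial (G.lapMatrix ℝ),
    (G.isSymm_lapMatrix (R := ℝ)).eq, Matrix.mul_assoc]
  rfl

/-- The spectrum of `G`: the eigenvalues of its normalized Laplacian with multiplicity, sorted in
decreasing order. -/
def graphSpectrum {n : ℕ} (G : SimpleGraph (Fin n)) : Fin n → ℝ := fun i =>
  (normLaplacian_isHermitian G).eigenvalues₀ (Fin.cast (Fintype.card_fin n).symm i)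

/-- The spectra realized by the `d`-bounded degree graphs with `n` vertices in the class `𝔎`. -/
def realizedSpectra (d : ℕ) (𝔎 : GraphClass) (n : ℕ) : Set (Fin n → ℝ) :=
  {x | ∃ G ∈ 𝔎.graphs n, DegreeBounded d G ∧ graphSpectrum G = x}

/-- `P` is `δ`-robustly spectral with respect to the class `𝔎` (and the degree bound `d`): for each
`n` there is a set `S` of spectra realized in `𝔎` such that the `n`-vertex members of `P` are
the `d`-bounded degree graphs in `𝔎` whose spectrum has `ℓ₁`-distance at most `δ n` to `S`. -/
def RobustlySpectral (d : ℕ) (𝔎 : GraphClass) (δ : ℝ) (P : GraphClass) : Prop :=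
  ∀ n : ℕ, ∃ S ⊆ realizedSpectra d 𝔎 n, ∀ G : SimpleGraph (Fin n),
    G ∈ P.graphs n ↔
      G ∈ 𝔎.graphs n ∧ DegreeBounded d G ∧ ∃ x ∈ S, ∑ i, |graphSpectrum G i - x i| ≤ δ * n

/-! ### The bounded degree graph model -/

/-- `G` is `ε`-far from `P`: every `d`-bounded degree graph on the same vertices with property `P`
differs from `G` in more than `ε d n` edges. -/
def IsFar {n : ℕ} (d : ℕ) (ε : ℝ) (P : GraphClass) (G : SimpleGraph (Fin n)) : Prop :=
  ∀ H : SimpleGraph (Fin n), DegreeBounded d H → H ∈ P.graphs n →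
    ε * d * n < ((symmDiff G.edgeSet H.edgeSet).ncard : ℝ)

/-- An answering function for the queries "what is the `i`-th neighbour of `v`?"; the value `none`
means that there is no such neighbour. -/
abbrev Oracle (n d : ℕ) : Type := Fin n → Fin d → Option (Fin n)

open scoped Classical in
/-- `O` represents `G` by adjacency lists: `O v` lists the neighbours of `v`, each once and in an
arbitrary order, in its first `deg v` places, followed by `none`. -/
structure Oracle.Represents {n d : ℕ} (O : Oracle n d) (G : SimpleGraph (Fin n)) : Prop where
  adj : ∀ v i w, O v i = some w → G.Adj v w
  inj : ∀ v i j w, O v i = some w → O v j = some w → i = j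
  isSome_iff : ∀ v i, (O v i).isSome ↔ (i : ℕ) < G.degree v

/-- A deterministic adaptive query algorithm: it either stops with an answer (`true` = accept,
`false` = reject) or asks for the `i`-th neighbour of `v` and continues depending on the reply. -/
inductive QueryTree (n d : ℕ) : Type
  | answer (b : Bool) : QueryTree n d
  | query (v : Fin n) (i : Fin d) (next : Option (Fin n) → QueryTree n d) : QueryTree n d

/-- The answer of the algorithm when its queries are answered by `O`. -/
def QueryTree.run {n d : ℕ} (O : Oracle n d) : QueryTree n d → Bool
  | .answer b => b
  | .query v i next => (next (O v i)).run O

/-- The number of queries that the algorithm makes when they are answered by `O`. -/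
def QueryTree.numQueries {n d : ℕ} (O : Oracle n d) : QueryTree n d → ℕ
  | .answer _ => 0
  | .query v i next => (next (O v i)).numQueries O + 1

/-- A randomized query algorithm: a probability distribution over deterministic ones. -/
abbrev RandomizedAlgorithm (n d : ℕ) : Type := PMF (QueryTree n d)

/-- The probability that the algorithm outputs `b` when its queries are answered by `O`. -/
def RandomizedAlgorithm.prob {n d : ℕ} (A : RandomizedAlgorithm n d) (O : Oracle n d) (b : Bool) :
    ℝ≥0∞ :=
  (PMF.map (QueryTree.run O) A) b

/-- The property `P` is testable in the bounded degree graph model with degree bound `d` when the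
input is restricted to the class `𝔊`: the number of queries is bounded independently of `n`. -/
def TestableOn (d : ℕ) (𝔊 P : GraphClass) : Prop :=
  ∃ q : ℝ → ℕ, ∀ ε : ℝ, 0 < ε → ∀ n : ℕ, ∃ A : RandomizedAlgorithm n d,
    (∀ T ∈ A.support, ∀ O : Oracle n d, T.numQueries O ≤ q ε) ∧
    ∀ G ∈ 𝔊.graphs n, DegreeBounded d G → ∀ O : Oracle n d, O.Represents G →
      (G ∈ P.graphs n → 2 / 3 ≤ A.prob O true) ∧
      (IsFar d ε P G → 2 / 3 ≤ A.prob O false)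

end SpectralTesting

end

/-! In a graph of girth larger than `m`, the closed walks of length `m` at a vertex stay inside a
tree, so the diagonal entries of the `m`-th power of the normalized Laplacian depend only on the
universal-cover ball around the vertex, encoded as its colour (`nLap_pow_apply_eq_of_color_eq`).
Traces of polynomials of bounded degree are therefore determined by colour statistics. The
`ℓ₁`-distance of two sorted spectra is the integral of the difference of their counting functions;
discretized by ramps and approximated by polynomials, it becomes, up to `γ n`, a sum of absolute
differences of finitely many traces (`exists_trace_tests`). So similar colour statistics force
similar spectra (`exists_spectrum_close_of_colorCount`), and colour statistics can be estimated from
boundedly many sampled vertices. The tester accepts if the estimate is close to the statistics of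
some member of `𝔊` with the property.

Suppose that the estimate is accurate and the tester accepts `G`. Then the spectrum of `G` has
distance at most `(δ + γ) n` from some `X` in the defining set, and `G` must be edited slightly to
bring this down to `δ n` (`exists_close`). The sum of trace differences is convex: replacing a
proportion `ρ` of the spectral distribution of `G` by that of `X` multiplies it by `1 - ρ`. This
gains about `ρ δ n`, which pays for all errors once `γ` is small compared with `ρ δ`.

The replacement (`exists_edited`) takes a vertex set `U` containing a proportion `ρ` of every colour
class and puts on it copies of a graph of bounded size with nearly the spectral distribution of `X`
(`exists_small_graph`). The obstacle is the edges leaving `U`: deleting order `ρ n` of them could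
cost more than is gained. They are removed by swaps instead: two distant edges `uv`, `u'v'` leaving
`U` with opposite colours are replaced by `uu'`, `vv'`, which preserves colours and large girth
(`color_swap`, `lt_egirth_swap`). As `U` is proportional, crossing edges of opposite types are
nearly balanced, so when no swap is possible only boundedly many remain (`card_crossing_le`). -/

noncomputable section

namespace SpectralTesting

open scoped Classical
open Finset

/-! ### Colour refinement -/

section Colors

variable {V W : Type} [Fintype V] [Fintype W]

/-- The neighbours of a vertex, as a finset. -/
def nbr (G : SimpleGraph V) (v : V) : Finset V := univ.filter (G.Adj v)

@[simp] theorem mem_nbr {G : SimpleGraph V} {v w : V} : w ∈ nbr G v ↔ G.Adj v w := by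
  simp [nbr]

theorem degree_eq_card_nbr (G : SimpleGraph V) (v : V) (inst : Fintype (G.neighborSet v)) :
    @SimpleGraph.degree V G v inst = #(nbr G v) := by
  rw [← SimpleGraph.card_neighborFinset_eq_degree]
  congr 1
  ext w
  simp

/-- Colour refinement: `color G j v` encodes the isomorphism type of the ball of radius `j` around
the lift of `v` to the universal cover of `G`. -/
def color (G : SimpleGraph V) : ℕ → V → ℕ
  | 0, _ => 0
  | j + 1, v => Encodable.encode ((nbr G v).val.map (color G j))

theorem color_succ_eq_iff {G : SimpleGraph V} {H : SimpleGraph W} {j : ℕ} {v : V} {w : W} :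
    color G (j + 1) v = color H (j + 1) w ↔
      (nbr G v).val.map (color G j) = (nbr H w).val.map (color H j) := by
  simp [color]

/-- Equal images amount to a matching of `s` with `t` along which `f` and `g` agree; by `hf` so do
`f'` and `g'` along the same matching. -/
theorem map_eq_map_of_map_eq_map {α β γ ε : Type*} {s : Multiset α} {t : Multiset β} {f : α → γ}
    {g : β → γ} {f' : α → ε} {g' : β → ε} (h : s.map f = t.map g)
    (hf : ∀ x ∈ s, ∀ y ∈ t, f x = g y → f' x = g' y) : s.map f' = t.map g' := by
  rw [← Multiset.rel_eq, Multiset.rel_map] at h ⊢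
  exact h.mono hf

theorem color_eq_of_succ {G : SimpleGraph V} {H : SimpleGraph W} {j : ℕ} :
    ∀ {v : V} {w : W}, color G (j + 1) v = color H (j + 1) w → color G j v = color H j w := by
  induction j with
  | zero => intros; rfl
  | succ j ih =>
    intro v w h
    rw [color_succ_eq_iff] at h ⊢
    exact map_eq_map_of_map_eq_map h fun x _ y _ hxy => ih hxy

theorem color_eq_of_le {G : SimpleGraph V} {H : SimpleGraph W} {i j : ℕ} (hij : i ≤ j) {v : V}
    {w : W} (h : color G j v = color H j w) : color G i v = color H i w := by
  induction j, hij using Nat.le_induction with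
  | base => exact h
  | succ j _ ih => exact ih (color_eq_of_succ h)

theorem card_nbr_eq_of_color_eq {G : SimpleGraph V} {H : SimpleGraph W} {j : ℕ} {v : V}
    {w : W} (h : color G (j + 1) v = color H (j + 1) w) : #(nbr G v) = #(nbr H w) := by
  rw [color_succ_eq_iff] at h
  simpa using congrArg Multiset.card h

/-- Sums over neighbours of quantities determined by the colours are determined by the colour. -/
theorem sum_nbr_eq_of_color_eq {G : SimpleGraph V} {H : SimpleGraph W} {j : ℕ} {v : V}
    {w : W} (h : color G (j + 1) v = color H (j + 1) w) {f : V → ℝ} {g : W → ℝ}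
    (hf : ∀ x ∈ nbr G v, ∀ y ∈ nbr H w, color G j x = color H j y → f x = g y) :
    ∑ x ∈ nbr G v, f x = ∑ y ∈ nbr H w, g y := by
  rw [color_succ_eq_iff] at h
  exact congrArg Multiset.sum (map_eq_map_of_map_eq_map h hf)

/-- For bounded degree graphs there are only finitely many colours of each level. -/
theorem exists_finset_color (d k : ℕ) : ∃ K : Finset ℕ, ∀ (n : ℕ) (G : SimpleGraph (Fin n)),
    (∀ v, #(nbr G v) ≤ d) → ∀ v, color G k v ∈ K := by
  induction k with
  | zero => exact ⟨{0}, by simp [color]⟩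
  | succ k ih =>
    obtain ⟨K, hK⟩ := ih
    -- A multiset of at most `d` elements of `K` is contained in `d` copies of `K`, which has
    -- finitely many submultisets.
    refine ⟨(Multiset.powerset (d • K.val)).toFinset.image Encodable.encode, fun n G hG v => ?_⟩
    simp only [color, mem_image, Multiset.mem_toFinset, Multiset.mem_powerset,
      Encodable.encode_inj, exists_eq_right]
    rw [Multiset.le_iff_count]
    intro a
    by_cases ha : a ∈ (nbr G v).val.map (color G k)
    · have haK : a ∈ K := by
        obtain ⟨w, _, rfl⟩ := Multiset.mem_map.1 ha
        exact hK n G hG w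
      rw [Multiset.count_nsmul, Multiset.count_eq_one_of_mem K.nodup haK]
      calc _ ≤ Multiset.card ((nbr G v).val.map (color G k)) := Multiset.count_le_card _ _
        _ ≤ d := by simpa using hG v
        _ = _ := by simp
    · rw [Multiset.count_eq_zero_of_notMem ha]
      exact Nat.zero_le _

end Colors

/-! ### Closed walks in graphs of large girth -/

section Moments

variable {V W : Type} [Fintype V] [Fintype W]

/-- The normalized Laplacian of a graph on an arbitrary finite type, given entrywise. -/
def nLap (G : SimpleGraph V) : Matrix V V ℝ := fun x y =>
  if x = y then (if #(nbr G x) = 0 then 0 else 1)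
  else if G.Adj x y then -((√(#(nbr G x) : ℝ))⁻¹ * (√(#(nbr G y) : ℝ))⁻¹) else 0

theorem normLaplacian_eq_nLap {n : ℕ} (G : SimpleGraph (Fin n)) : normLaplacian G = nLap G := by
  ext x y
  simp only [normLaplacian, nLap, Matrix.mul_diagonal, Matrix.diagonal_mul,
    SimpleGraph.lapMatrix, Matrix.sub_apply, SimpleGraph.degMatrix, Matrix.diagonal_apply,
    SimpleGraph.adjMatrix_apply, degree_eq_card_nbr]
  by_cases hxy : x = y
  · subst hxy
    by_cases h0 : #(nbr G x) = 0
    · simp [h0]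
    · have : (0 : ℝ) < #(nbr G x) := by positivity
      have h1 : √(#(nbr G x) : ℝ) ≠ 0 := by positivity
      simp only [if_true, SimpleGraph.irrefl, if_false, sub_zero, h0]
      field_simp
      rw [Real.sq_sqrt this.le]
  · by_cases ha : G.Adj x y <;> simp [hxy, ha]

theorem nLap_comm (G : SimpleGraph V) (x y : V) : nLap G x y = nLap G y x := by
  by_cases hxy : x = y
  · rw [hxy]
  · simp only [nLap, hxy, Ne.symm hxy, if_false, G.adj_comm x y, mul_comm]

theorem nLap_ne_zero {G : SimpleGraph V} {x y : V} (h : nLap G x y ≠ 0) :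
    x = y ∨ G.Adj x y := by
  by_contra! h'
  exact h (by simp [nLap, h'])

theorem abs_nLap_le_one (G : SimpleGraph V) (x y : V) : |nLap G x y| ≤ 1 := by
  have key : ∀ z : V, 0 ≤ (√(#(nbr G z) : ℝ))⁻¹ ∧ (√(#(nbr G z) : ℝ))⁻¹ ≤ 1 := by
    intro z
    refine ⟨by positivity, ?_⟩
    rcases Nat.eq_zero_or_pos #(nbr G z) with h | h
    · simp [h]
    · apply inv_le_one_of_one_le₀
      rw [Real.one_le_sqrt]
      exact_mod_cast h
  unfold nLap
  split_ifs
  · simp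
  · simp
  · rw [abs_neg, abs_of_nonneg (mul_nonneg (key x).1 (key y).1)]
    exact mul_le_one₀ (key x).2 (key y).1 (key y).2
  · simp

theorem nLap_self_eq_of_color_eq {G : SimpleGraph V} {H : SimpleGraph W} {j : ℕ} {v : V}
    {w : W} (h : color G (j + 1) v = color H (j + 1) w) : nLap G v v = nLap H w w := by
  simp [nLap, card_nbr_eq_of_color_eq h]

theorem nLap_eq_of_color_eq {G : SimpleGraph V} {H : SimpleGraph W} {j : ℕ} {v x : V}
    {w y : W} (h : color G (j + 1) v = color H (j + 1) w)
    (h' : color G (j + 1) x = color H (j + 1) y) (hx : G.Adj v x) (hy : H.Adj w y) :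
    nLap G v x = nLap H w y := by
  simp [nLap, card_nbr_eq_of_color_eq h, card_nbr_eq_of_color_eq h', hx, hy, hx.ne, hy.ne]

/-- The matrix `M` with the rows and columns in `S` replaced by zero. -/
def cut {V : Type} (M : Matrix V V ℝ) (S : Finset V) : Matrix V V ℝ := fun x y =>
  if x ∈ S ∨ y ∈ S then 0 else M x y

@[simp] theorem cut_empty {V : Type} (M : Matrix V V ℝ) : cut M ∅ = M := by
  ext x y; simp [cut]

theorem cut_cut {V : Type} (M : Matrix V V ℝ) (S T : Finset V) : cut (cut M S) T = cut M (S ∪ T) := by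
  ext x y
  simp only [cut, mem_union]
  grind

/-- Split a walk from `x` to `v` at its first visit to `v`: `j` steps avoiding `v`, one step into
`v`, then a closed walk at `v` in the remaining `m - 1 - j` steps. -/
theorem pow_apply_of_ne (M : Matrix V V ℝ) {x v : V} (hx : x ≠ v) (m : ℕ) :
    (M ^ m) x v = ∑ j ∈ range m, (∑ y ∈ univ.erase v, (cut M {v} ^ j) x y * M y v) *
      (M ^ (m - 1 - j)) v v := by
  induction m generalizing x with
  | zero => simp [hx]
  | succ m ih =>
    rw [pow_succ', Matrix.mul_apply, ← add_sum_erase _ _ (mem_univ v), sum_range_succ']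
    have h0 : (∑ y ∈ univ.erase v, (cut M {v} ^ 0) x y * M y v) = M x v := by
      simp [Matrix.one_apply, hx]
    simp only [h0]
    rw [add_comm]
    congr 1
    have h1 : ∀ z ∈ univ.erase v, M x z * (M ^ m) z v = ∑ j ∈ range m,
        cut M {v} x z * ((∑ y ∈ univ.erase v, (cut M {v} ^ j) z y * M y v) *
          (M ^ (m - 1 - j)) v v) := by
      intro z hz
      have hz := ne_of_mem_erase hz
      rw [ih hz, mul_sum]
      simp [cut, hx, hz]
    rw [sum_congr rfl h1, sum_comm]
    refine sum_congr rfl fun j _ => ?_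
    have h2 : m + 1 - 1 - (j + 1) = m - 1 - j := by omega
    rw [h2]
    simp_rw [← mul_assoc]
    rw [← sum_mul]
    congr 1
    simp_rw [mul_sum]
    rw [sum_comm]
    refine sum_congr rfl fun y _ => ?_
    rw [pow_succ', Matrix.mul_apply, sum_mul]
    simp_rw [← mul_assoc]
    rw [← add_sum_erase univ _ (mem_univ v)]
    simp [cut]

/-- Decomposition of closed walks at `v` according to their first return to `v`. -/
theorem pow_succ_apply_self (M : Matrix V V ℝ) (v : V) (m : ℕ) :
    (M ^ (m + 1)) v v = M v v * (M ^ m) v v + ∑ j ∈ range m, (∑ x ∈ univ.erase v,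
      ∑ y ∈ univ.erase v, M v x * (cut M {v} ^ j) x y * M y v) * (M ^ (m - 1 - j)) v v := by
  rw [pow_succ', Matrix.mul_apply, ← add_sum_erase _ _ (mem_univ v)]
  congr 1
  rw [sum_congr rfl fun x hx => by rw [pow_apply_of_ne M (ne_of_mem_erase hx) m]]
  simp_rw [mul_sum, ← mul_assoc]
  rw [sum_comm]
  refine sum_congr rfl fun j _ => ?_
  rw [sum_mul]
  refine sum_congr rfl fun x _ => ?_
  rw [mul_sum]
  simp_rw [mul_assoc]

/-- The diagonal of `nLap` allows a step to stay in place, so `j` is only an upper bound for the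
length. -/
theorem exists_walk_of_cut_pow_ne_zero (G : SimpleGraph V) {S : Finset V} {j : ℕ} :
    ∀ {x y : V}, x ∉ S → (cut (nLap G) S ^ j) x y ≠ 0 →
      ∃ p : G.Walk x y, p.length ≤ j ∧ ∀ z ∈ p.support, z ∉ S := by
  induction j with
  | zero =>
    intro x y hx h
    have : x = y := by
      by_contra hne
      exact h (by simp [hne])
    subst this
    exact ⟨.nil, by simp, by simpa using hx⟩
  | succ j ih =>
    intro x y hx h
    rw [pow_succ', Matrix.mul_apply] at h
    obtain ⟨z, _, hz⟩ := exists_ne_zero_of_sum_ne_zero h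
    have h1 : cut (nLap G) S x z ≠ 0 := left_ne_zero_of_mul hz
    have h2 := right_ne_zero_of_mul hz
    have hzS : z ∉ S := fun hzS => h1 (by simp [cut, hzS])
    have h3 : nLap G x z ≠ 0 := by simpa [cut, hx, hzS] using h1
    obtain ⟨p, hp, hps⟩ := ih hzS h2
    rcases nLap_ne_zero h3 with rfl | ha
    · exact ⟨p, by omega, hps⟩
    · refine ⟨.cons ha p, by simpa using hp, ?_⟩
      simpa [hx] using hps

theorem egirth_le_of_walk {V : Type} {G : SimpleGraph V} {u v : V} (h : G.Adj u v) (p : G.Walk v u)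
    (hp : s(u, v) ∉ p.edges) : G.egirth ≤ (p.length + 1 : ℕ) := by
  have hc : (SimpleGraph.Walk.cons h p.bypass).IsCycle := by
    rw [SimpleGraph.Walk.cons_isCycle_iff]
    exact ⟨p.bypass_isPath, fun h' => hp (p.edges_bypass_subset_edges h')⟩
  refine (SimpleGraph.egirth_le_length hc).trans ?_
  simpa using p.length_bypass_le_length

theorem egirth_le_of_walk_avoiding {V : Type} {G : SimpleGraph V} {v x y : V} (hx : G.Adj v x)
    (hy : G.Adj v y) (hxy : x ≠ y) (p : G.Walk x y) (hp : v ∉ p.support) :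
    G.egirth ≤ (p.length + 2 : ℕ) := by
  have := egirth_le_of_walk hx (p.concat hy.symm) ?_
  · simpa [add_assoc] using this
  · rw [SimpleGraph.Walk.edges_concat]
    simp only [List.concat_eq_append, List.mem_append, List.mem_singleton, not_or]
    refine ⟨fun h => hp (p.fst_mem_support_of_mem_edges h), ?_⟩
    simp [hxy, hy.ne]

/-- A walk of length at most `j` between two distinct neighbours of `v` that avoids `v` would close
up through `v` to a cycle of length at most `j + 2`. -/
theorem cut_pow_apply_eq_zero {G : SimpleGraph V} {j : ℕ} (hg : ((j + 2 : ℕ) : ℕ∞) < G.egirth)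
    {v x y : V} (hx : G.Adj v x) (hy : G.Adj v y) (hxy : x ≠ y) (S : Finset V) (hv : v ∈ S)
    (hS : x ∉ S) : (cut (nLap G) S ^ j) x y = 0 := by
  by_contra h
  obtain ⟨p, hp, hps⟩ := exists_walk_of_cut_pow_ne_zero G hS h
  have := egirth_le_of_walk_avoiding hx hy hxy p fun h' => hps _ h' hv
  exact absurd (hg.trans_le this) (by simpa using hp)

/-- Short walks in the branch of `x` that avoid `v` cannot reach another neighbour `p` of `v`, so
deleting `p` as well changes nothing. -/
theorem cut_insert_pow_apply {G : SimpleGraph V} {v x p : V} (hx : G.Adj v x) (hp : G.Adj v p)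
    (hxp : x ≠ p) {j : ℕ} (hg : ((j + 2 : ℕ) : ℕ∞) < G.egirth) (y : V) :
    (cut (nLap G) ({p} ∪ {v}) ^ j) x y = (cut (nLap G) {v} ^ j) x y := by
  induction j generalizing y with
  | zero => rfl
  | succ j ih =>
    have hg' : ((j + 2 : ℕ) : ℕ∞) < G.egirth :=
      lt_of_le_of_lt (by exact_mod_cast (by omega : j + 2 ≤ j + 1 + 2)) hg
    by_cases hyp : y = p
    · subst hyp
      rw [cut_pow_apply_eq_zero hg hx hp hxp _ (by simp) (by simp [hxp, hx.ne']),
        cut_pow_apply_eq_zero hg hx hp hxp _ (by simp) (by simp [hx.ne'])]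
    · rw [pow_succ, pow_succ, Matrix.mul_apply, Matrix.mul_apply]
      refine sum_congr rfl fun z _ => ?_
      rw [ih hg' z]
      by_cases hzp : z = p
      · subst hzp
        rw [cut_pow_apply_eq_zero hg' hx hp hxp _ (by simp) (by simp [hx.ne'])]
        simp
      · simp [cut, hzp, hyp]

/-- The first return decomposition in a graph of large girth. -/
theorem cut_pow_succ_apply_self {G : SimpleGraph V} {m : ℕ} (hg : ((m + 1 : ℕ) : ℕ∞) < G.egirth)
    {v : V} {S : Finset V} (hS : S = ∅ ∨ ∃ p, G.Adj v p ∧ S = {p}) :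
    (cut (nLap G) S ^ (m + 1)) v v = nLap G v v * (cut (nLap G) S ^ m) v v +
      ∑ j ∈ range m, (∑ x ∈ nbr G v \ S, nLap G v x ^ 2 * (cut (nLap G) {v} ^ j) x x) *
        (cut (nLap G) S ^ (m - 1 - j)) v v := by
  have hv : v ∉ S := by
    rcases hS with rfl | ⟨p, hp, rfl⟩
    · simp
    · simpa using hp.ne
  rw [pow_succ_apply_self, cut_cut]
  congr 1
  · simp [cut, hv]
  refine sum_congr rfl fun j hj => ?_
  have hj : j + 2 ≤ m + 1 := by have := mem_range.1 hj; omega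
  have hgj : ((j + 2 : ℕ) : ℕ∞) < G.egirth := lt_of_le_of_lt (by exact_mod_cast hj) hg
  congr 1
  have hsub : nbr G v \ S ⊆ univ.erase v := by
    intro x hx
    have := (mem_nbr.1 (mem_sdiff.1 hx).1).ne'
    simpa using this
  have hz : ∀ x, x ≠ v → x ∉ nbr G v \ S → cut (nLap G) S v x = 0 := by
    intro x hxv hx
    simp only [cut, hv, false_or]
    split_ifs with hxS
    · rfl
    · by_contra h
      rcases nLap_ne_zero h with h | h
      · exact hxv h.symm
      · exact hx (by simp [h, hxS])
  rw [← sum_subset hsub]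
  · refine sum_congr rfl fun x hx => ?_
    obtain ⟨hxv, hxS⟩ := mem_sdiff.1 hx
    rw [mem_nbr] at hxv
    -- By the girth an excursion from `v` returns through the neighbour by which it left.
    rw [sum_eq_single x]
    · have : (cut (nLap G) (S ∪ {v}) ^ j) x x = (cut (nLap G) {v} ^ j) x x := by
        rcases hS with rfl | ⟨p, hp, rfl⟩
        · simp
        · exact cut_insert_pow_apply hxv hp (by simpa using hxS) hgj x
      rw [this]
      simp only [cut, hv, hxS, or_self, if_false, nLap_comm G x v]
      ring
    · intro y hy hyx
      by_cases hyS : y ∈ nbr G v \ S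
      · have hyv := mem_nbr.1 (mem_sdiff.1 hyS).1
        rw [cut_pow_apply_eq_zero hgj hxv hyv hyx.symm _ (by simp) (by simp [hxS, hxv.ne'])]
        simp
      · have h0 := hz y (ne_of_mem_erase hy) hyS
        have : cut (nLap G) S y v = 0 := by
          rw [← h0]; simp only [cut, nLap_comm G y v, or_comm]
        rw [this]; simp
    · intro h
      exact absurd (hsub hx) h
  · intro x hx hx'
    rw [hz x (ne_of_mem_erase hx) hx']
    simp

/-- The second part is what the induction needs: an excursion from `v` through its neighbour `x` is
a shorter closed walk at `x` in the graph with the parent `v` deleted. -/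
theorem cut_pow_apply_eq_of_color_eq {G : SimpleGraph V} {H : SimpleGraph W} {m : ℕ} :
    ∀ (_ : (m : ℕ∞) < G.egirth) (_ : (m : ℕ∞) < H.egirth) {v : V} {w : W}
      (_ : color G (m + 1) v = color H (m + 1) w),
      (nLap G ^ m) v v = (nLap H ^ m) w w ∧ ∀ p q, G.Adj v p → H.Adj w q →
        color G (m + 1) p = color H (m + 1) q →
        (cut (nLap G) {p} ^ m) v v = (cut (nLap H) {q} ^ m) w w := by
  induction m using Nat.strong_induction_on with
  | _ m ih =>
  intro hG hH v w hc
  rcases m with _ | m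
  · simp
  have lt {i : ℕ} (hi : i < m + 1) : (i : ℕ∞) < G.egirth ∧ (i : ℕ∞) < H.egirth := by
    have : (i : ℕ∞) ≤ (m + 1 : ℕ) := by exact_mod_cast hi.le
    exact ⟨this.trans_lt hG, this.trans_lt hH⟩
  have hterm : ∀ j < m, ∀ x ∈ nbr G v, ∀ y ∈ nbr H w,
      color G (m + 1) x = color H (m + 1) y →
      nLap G v x ^ 2 * (cut (nLap G) {v} ^ j) x x =
        nLap H w y ^ 2 * (cut (nLap H) {w} ^ j) y y := by
    intro j hj x hx y hy hxy
    rw [mem_nbr] at hx hy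
    rw [nLap_eq_of_color_eq (color_eq_of_succ hc) hxy hx hy]
    congr 1
    exact (ih j (by omega) (lt (by omega)).1 (lt (by omega)).2
      (color_eq_of_le (by omega) hxy)).2 v w hx.symm hy.symm (color_eq_of_le (by omega) hc)
  have hsum : ∀ j < m, ∑ x ∈ nbr G v, nLap G v x ^ 2 * (cut (nLap G) {v} ^ j) x x =
      ∑ y ∈ nbr H w, nLap H w y ^ 2 * (cut (nLap H) {w} ^ j) y y := fun j hj =>
    sum_nbr_eq_of_color_eq hc (hterm j hj)
  constructor
  · have h1 := cut_pow_succ_apply_self hG (v := v) (S := ∅) (.inl rfl)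
    have h2 := cut_pow_succ_apply_self hH (v := w) (S := ∅) (.inl rfl)
    simp only [cut_empty, sdiff_empty] at h1 h2
    rw [h1, h2, nLap_self_eq_of_color_eq hc]
    congr 1
    · rw [(ih m (by omega) (lt (by omega)).1 (lt (by omega)).2 (color_eq_of_succ hc)).1]
    · refine sum_congr rfl fun j hj => ?_
      have hj := mem_range.1 hj
      rw [hsum j hj, (ih (m - 1 - j) (by omega) (lt (by omega)).1 (lt (by omega)).2
        (color_eq_of_le (by omega) hc)).1]
  · intro p q hp hq hpq
    rw [cut_pow_succ_apply_self hG (.inr ⟨p, hp, rfl⟩),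
      cut_pow_succ_apply_self hH (.inr ⟨q, hq, rfl⟩), nLap_self_eq_of_color_eq hc]
    congr 1
    · rw [(ih m (by omega) (lt (by omega)).1 (lt (by omega)).2 (color_eq_of_succ hc)).2 p q hp hq
        (color_eq_of_succ hpq)]
    · refine sum_congr rfl fun j hj => ?_
      have hj := mem_range.1 hj
      rw [(ih (m - 1 - j) (by omega) (lt (by omega)).1 (lt (by omega)).2
        (color_eq_of_le (by omega) hc)).2 p q hp hq (color_eq_of_le (by omega) hpq)]
      congr 1
      -- With the parent deleted, the sum is that over all neighbours minus the term of the parent;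
      -- both are determined by the colours.
      have h1 := add_sum_erase (nbr G v) (fun x => nLap G v x ^ 2 * (cut (nLap G) {v} ^ j) x x)
        (mem_nbr.2 hp)
      have h2 := add_sum_erase (nbr H w) (fun x => nLap H w x ^ 2 * (cut (nLap H) {w} ^ j) x x)
        (mem_nbr.2 hq)
      rw [sdiff_singleton_eq_erase, sdiff_singleton_eq_erase]
      have h3 := hterm j hj p (mem_nbr.2 hp) q (mem_nbr.2 hq)
        (color_eq_of_succ hpq)
      have h4 := hsum j hj
      linarith

/-- In graphs of girth larger than `m` the number of closed walks of length `m` at a vertex,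
weighted by the normalized Laplacian, is determined by its colour. -/
theorem nLap_pow_apply_eq_of_color_eq {G : SimpleGraph V} {H : SimpleGraph W} {m : ℕ}
    (hG : (m : ℕ∞) < G.egirth) (hH : (m : ℕ∞) < H.egirth) {v : V} {w : W}
    (h : color G (m + 1) v = color H (m + 1) w) : (nLap G ^ m) v v = (nLap H ^ m) w w :=
  (cut_pow_apply_eq_of_color_eq hG hH h).1

end Moments

/-! ### The `ℓ₁`-distance of sorted sequences through polynomial averages -/

section SpectralDistance

/-- A ramp decreasing from `h` to `0` on the interval from `a` to `a + h`. -/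
def ramp (a h x : ℝ) : ℝ := max 0 (min h (a + h - x))

theorem ramp_nonneg (a h x : ℝ) : 0 ≤ ramp a h x := le_max_left _ _

theorem ramp_le {a h x : ℝ} (hh : 0 ≤ h) : ramp a h x ≤ h := max_le hh (min_le_left _ _)

theorem ramp_antitone (a h : ℝ) : Antitone (ramp a h) := by
  intro x y hxy
  unfold ramp
  gcongr

theorem continuous_ramp (a h : ℝ) : Continuous (ramp a h) := by
  unfold ramp
  fun_prop

theorem sum_ramp (a : ℝ) {h : ℝ} (hh : 0 ≤ h) (x : ℝ) (N : ℕ) :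
    ∑ l ∈ range N, ramp (a + l * h) h x = max 0 (min (N * h) (a + N * h - x)) := by
  induction N with
  | zero => simp
  | succ N ih =>
    rw [sum_range_succ, ih]
    have : 0 ≤ N * h := by positivity
    unfold ramp
    push_cast
    rcases le_total (a + N * h - x) 0 with h1 | h1
    · rw [max_eq_left (a := (0 : ℝ)) (b := min (N * h) (a + N * h - x))
        ((min_le_right _ _).trans h1), min_eq_right (a := h) (by linarith),
        min_eq_right (a := ((N : ℝ) + 1) * h) (by linarith), zero_add]
      congr 1; ring
    · rw [min_eq_left (a := h) (by linarith), max_eq_right (le_min this h1), max_eq_right hh,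
        max_eq_right (le_min (by linarith) (by linarith)), ← min_add_add_right]
      congr 1 <;> ring

/-- All ramps are decreasing, so the differences have one sign, and on the interval the ramps add up
to a linear function of slope `-1`. -/
theorem sum_abs_ramp_sub {a h x y : ℝ} (hh : 0 ≤ h) {N : ℕ} (hx : x ∈ Set.Icc a (a + N * h))
    (hy : y ∈ Set.Icc a (a + N * h)) :
    ∑ l ∈ range N, |ramp (a + l * h) h x - ramp (a + l * h) h y| = |x - y| := by
  wlog hxy : x ≤ y generalizing x y
  · rw [abs_sub_comm x y, ← this hy hx (le_of_not_ge hxy)]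
    exact sum_congr rfl fun l _ => abs_sub_comm _ _
  have key : ∀ z ∈ Set.Icc a (a + N * h), ∑ l ∈ range N, ramp (a + l * h) h z = a + N * h - z := by
    rintro z ⟨h1, h2⟩
    rw [sum_ramp a hh, min_eq_right (by linarith), max_eq_right (by linarith)]
  rw [sum_congr rfl fun l _ => abs_of_nonneg (sub_nonneg.2 (ramp_antitone _ _ hxy)),
    sum_sub_distrib, key x hx, key y hy, abs_of_nonpos (by linarith)]
  ring

theorem card_filter_ramp_le_one {a h x : ℝ} (hh : 0 ≤ h) (N : ℕ) :
    #((range N).filter fun l : ℕ => 0 < ramp (a + l * h) h x ∧ ramp (a + l * h) h x < h) ≤ 1 := by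
  rw [card_le_one]
  have key : ∀ l : ℕ, 0 < ramp (a + l * h) h x ∧ ramp (a + l * h) h x < h →
      a + l * h < x ∧ x < a + (l + 1) * h := by
    intro l hl
    simp only [ramp, lt_max_iff, max_lt_iff, lt_min_iff, min_lt_iff, lt_irrefl, false_or] at hl
    constructor <;> linarith
  intro l hl l' hl'
  have h1 := key l (mem_filter.1 hl).2
  have h2 := key l' (mem_filter.1 hl').2
  by_contra hne
  rcases Nat.lt_or_gt_of_ne hne with hlt | hlt
  · have : (l : ℝ) + 1 ≤ l' := by exact_mod_cast hlt
    nlinarith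
  · have : (l' : ℝ) + 1 ≤ l := by exact_mod_cast hlt
    nlinarith

/-- Apart from intermediate values, `a` and `b` are step functions jumping once from `0` to `h`. Two
such functions are pointwise comparable, so the absolute value can be taken outside the sum; an
index with an intermediate value costs at most `2 * h`. -/
theorem sum_abs_sub_le_of_monotone {n : ℕ} {h : ℝ} {a b : Fin n → ℝ}
    (ha : Monotone a) (hb : Monotone b) (ha0 : ∀ i, 0 ≤ a i) (hb0 : ∀ i, 0 ≤ b i)
    (hah : ∀ i, a i ≤ h) (hbh : ∀ i, b i ≤ h) :
    ∑ i, |a i - b i| ≤ |∑ i, a i - ∑ i, b i| +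
      2 * h * (∑ i, (if 0 < a i ∧ a i < h then 1 else 0) +
        ∑ i, (if 0 < b i ∧ b i < h then 1 else 0)) := by
  -- This decides which sequence jumps first, and hence is the larger one away from the intermediate
  -- values.
  by_cases hc : ∃ i, a i = 0 ∧ b i = h
  · obtain ⟨j, hj, hj'⟩ := hc
    have key : ∀ i, |a i - b i| ≤ (b i - a i) + 2 * h * ((if 0 < a i ∧ a i < h then 1 else 0) +
        (if 0 < b i ∧ b i < h then 1 else 0)) := by
      intro i
      have h1 := ha0 i; have h2 := hb0 i; have h3 := hah i; have h4 := hbh i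
      rw [abs_le]
      rcases le_total i j with hij | hij
      · have := ha hij
        have h5 : a i = 0 := by linarith
        split_ifs <;> constructor <;> linarith
      · have := hb hij
        have h5 : b i = h := by linarith
        split_ifs <;> constructor <;> linarith
    calc _ ≤ ∑ i, _ := sum_le_sum fun i _ => key i
      _ = (∑ i, b i - ∑ i, a i) + _ := by
        rw [sum_add_distrib, sum_sub_distrib, ← mul_sum, sum_add_distrib]
      _ ≤ _ := by
        gcongr
        rw [abs_sub_comm]
        exact le_abs_self _
  · have key : ∀ i, |a i - b i| ≤ (a i - b i) + 2 * h * ((if 0 < a i ∧ a i < h then 1 else 0) +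
        (if 0 < b i ∧ b i < h then 1 else 0)) := by
      intro i
      have h1 := ha0 i; have h2 := hb0 i; have h3 := hah i; have h4 := hbh i
      have h5 : ¬ (a i = 0 ∧ b i = h) := fun h => hc ⟨i, h⟩
      rw [abs_le]
      split_ifs with h6 h7 h7
      · constructor <;> linarith
      · constructor <;> linarith
      · constructor <;> linarith
      · have h8 : b i ≤ a i := by
          rcases h1.eq_or_lt with h | h
          · rcases h2.eq_or_lt with h' | h'
            · linarith
            · exact absurd ⟨h.symm, le_antisymm h4 (not_lt.1 fun h'' => h7 ⟨h', h''⟩)⟩ h5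
          · have := not_lt.1 fun h'' => h6 ⟨h, h''⟩
            linarith
        constructor <;> linarith
    calc _ ≤ ∑ i, _ := sum_le_sum fun i _ => key i
      _ = (∑ i, a i - ∑ i, b i) + _ := by
        rw [sum_add_distrib, sum_sub_distrib, ← mul_sum, sum_add_distrib]
      _ ≤ _ := by
        gcongr
        exact le_abs_self _

/-- For sorted sequences the `ℓ₁`-distance is determined, up to a small error, by the averages of
finitely many ramps. -/
theorem abs_sum_abs_sub_sub_le {a h : ℝ} (hh : 0 < h) (N : ℕ) {n : ℕ} {x y : Fin n → ℝ}
    (hx : Antitone x) (hy : Antitone y) (hxI : ∀ i, x i ∈ Set.Icc a (a + N * h))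
    (hyI : ∀ i, y i ∈ Set.Icc a (a + N * h)) :
    |∑ i, |x i - y i| - (∑ l ∈ range N,
      |∑ i, ramp (a + l * h) h (x i) - ∑ i, ramp (a + l * h) h (y i)|)| ≤ 4 * h * n := by
  have h1 : ∑ i, |x i - y i| = ∑ l ∈ range N, ∑ i,
      |ramp (a + l * h) h (x i) - ramp (a + l * h) h (y i)| := by
    rw [sum_comm]
    exact sum_congr rfl fun i _ => (sum_abs_ramp_sub hh.le (hxI i) (hyI i)).symm
  -- Each point lies strictly inside the sloping part of at most one ramp, so summed over all ramps
  -- there are at most `n` exceptional indices per sequence.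
  have hcell : ∀ z : Fin n → ℝ, ∑ l ∈ range N, ∑ i,
      (if 0 < ramp (a + l * h) h (z i) ∧ ramp (a + l * h) h (z i) < h then (1 : ℝ) else 0) ≤ n := by
    intro z
    rw [sum_comm]
    calc _ ≤ ∑ i : Fin n, (1 : ℝ) := by
          refine sum_le_sum fun i _ => ?_
          rw [sum_boole]
          exact_mod_cast card_filter_ramp_le_one hh.le N
      _ = n := by simp
  have h2 := sum_le_sum fun l (_ : l ∈ range N) => sum_abs_sub_le_of_monotone
    (a := fun i => ramp (a + l * h) h (x i)) (b := fun i => ramp (a + l * h) h (y i))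
    ((ramp_antitone _ _).comp hx) ((ramp_antitone _ _).comp hy) (fun _ => ramp_nonneg _ _ _)
    (fun _ => ramp_nonneg _ _ _) (fun _ => ramp_le hh.le) (fun _ => ramp_le hh.le)
  rw [sum_add_distrib, ← mul_sum, sum_add_distrib] at h2
  have h3 := hcell x
  have h4 := hcell y
  have h5 : ∑ l ∈ range N,
      |∑ i, ramp (a + l * h) h (x i) - ∑ i, ramp (a + l * h) h (y i)| ≤ ∑ i, |x i - y i| := by
    rw [h1]
    refine sum_le_sum fun l _ => ?_
    rw [← sum_sub_distrib]
    exact abs_sum_le_sum_abs _ _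
  have h6 : 2 * h * (∑ l ∈ range N, ∑ i, (if 0 < ramp (a + l * h) h (x i) ∧
      ramp (a + l * h) h (x i) < h then (1 : ℝ) else 0) + ∑ l ∈ range N, ∑ i,
      (if 0 < ramp (a + l * h) h (y i) ∧ ramp (a + l * h) h (y i) < h then (1 : ℝ) else 0)) ≤
      2 * h * (n + n) := by gcongr
  have h0 : (0 : ℝ) ≤ 4 * h * n := by positivity
  rw [abs_le]
  constructor
  · linarith
  · rw [h1]
    linarith

/-- For sorted sequences the `ℓ₁`-distance is determined, up to a small error, by the averages of
finitely many polynomials. -/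
theorem exists_polynomial_tests {B γ : ℝ} (hB : 0 < B) (hγ : 0 < γ) :
    ∃ (N : ℕ) (p : ℕ → Polynomial ℝ), ∀ (n : ℕ) (x y : Fin n → ℝ), Antitone x → Antitone y →
      (∀ i, |x i| ≤ B) → (∀ i, |y i| ≤ B) →
      |∑ i, |x i - y i| - (∑ l ∈ range N, |∑ i, (p l).eval (x i) - ∑ i, (p l).eval (y i)|)| ≤
        γ * n := by
  -- The mesh `2 * B / N` makes the ramp error `4 * h * n` at most `γ / 2 * n`; with `η` below, the
  -- polynomial approximation costs `N * (2 * n * η) = γ / 2 * n`.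
  obtain ⟨N, hN⟩ := exists_nat_gt (16 * B / γ)
  have hN0 : (0 : ℝ) < N := lt_trans (by positivity) hN
  set h := 2 * B / N with hdef
  have hh : 0 < h := by positivity
  have hNh : N * h = 2 * B := by rw [hdef]; field_simp
  have h8 : 4 * h ≤ γ / 2 := by
    rw [div_lt_iff₀ hγ] at hN
    rw [hdef, mul_div_assoc', div_le_iff₀ hN0]
    linarith
  set η := γ / (4 * N) with hη
  have hη0 : 0 < η := by positivity
  have hp : ∀ l : ℕ, ∃ q : Polynomial ℝ, ∀ x ∈ Set.Icc (-B) B,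
      |q.eval x - ramp (-B + l * h) h x| < η := fun l =>
    exists_polynomial_near_of_continuousOn (-B) B _ (continuous_ramp _ _).continuousOn η hη0
  choose p hp using hp
  refine ⟨N, p, fun n x y hx hy hxB hyB => ?_⟩
  have hI : ∀ z : Fin n → ℝ, (∀ i, |z i| ≤ B) → ∀ i, z i ∈ Set.Icc (-B) B := fun z hz i =>
    abs_le.1 (hz i)
  have hEq : -B + N * h = B := by linarith
  have h1 := abs_sum_abs_sub_sub_le hh N hx hy (by rw [hEq]; exact hI x hxB)
    (by rw [hEq]; exact hI y hyB)
  have h2 : ∀ z : Fin n → ℝ, (∀ i, |z i| ≤ B) → ∀ l,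
      |∑ i, (p l).eval (z i) - ∑ i, ramp (-B + l * h) h (z i)| ≤ n * η := by
    intro z hz l
    rw [← sum_sub_distrib]
    calc _ ≤ ∑ i : Fin n, |(p l).eval (z i) - ramp (-B + l * h) h (z i)| :=
          abs_sum_le_sum_abs _ _
      _ ≤ ∑ i : Fin n, η := sum_le_sum fun i _ => (hp l _ (hI z hz i)).le
      _ = n * η := by simp
  have h3 : |∑ l ∈ range N, |∑ i, ramp (-B + l * h) h (x i) - ∑ i, ramp (-B + l * h) h (y i)| -
      (∑ l ∈ range N, |∑ i, (p l).eval (x i) - ∑ i, (p l).eval (y i)|)| ≤ γ / 2 * n := by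
    rw [← sum_sub_distrib]
    calc _ ≤ ∑ l ∈ range N, _ := abs_sum_le_sum_abs _ _
      _ ≤ ∑ l ∈ range N, 2 * (n * η) := by
        refine sum_le_sum fun l _ => (abs_abs_sub_abs_le_abs_sub _ _).trans ?_
        have := abs_le.1 (h2 x hxB l)
        have := abs_le.1 (h2 y hyB l)
        rw [abs_le]
        constructor <;> linarith
      _ = γ / 2 * n := by
        rw [sum_const, card_range, nsmul_eq_mul, hη]
        field_simp
        ring
  have h4 : 4 * h * n ≤ γ / 2 * n := by gcongr
  have := abs_le.1 h1
  have := abs_le.1 h3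
  rw [abs_le]
  constructor <;> linarith

end SpectralDistance

/-! ### Traces of polynomials of the normalized Laplacian -/

section Traces

variable {V : Type} [Fintype V]

/-- The diagonal entry at `v` of the polynomial `p` of the normalized Laplacian. -/
def localEval (p : Polynomial ℝ) (G : SimpleGraph V) (v : V) : ℝ :=
  ∑ m ∈ range (p.natDegree + 1), p.coeff m * (nLap G ^ m) v v

/-- The trace of the polynomial `p` of the normalized Laplacian. -/
def polyTrace (p : Polynomial ℝ) (G : SimpleGraph V) : ℝ := ∑ v, localEval p G v

theorem sum_eval_graphSpectrum {n : ℕ} (p : Polynomial ℝ) (G : SimpleGraph (Fin n)) :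
    ∑ i, p.eval (graphSpectrum G i) = polyTrace p G := by
  have hG := normLaplacian_isHermitian G
  have h1 : ∑ i, p.eval (graphSpectrum G i) = ∑ i, p.eval (hG.eigenvalues i) := by
    unfold graphSpectrum Matrix.IsHermitian.eigenvalues
    refine Fintype.sum_equiv ((finCongr (Fintype.card_fin n).symm).trans
      (Fintype.equivOfCardEq (Fintype.card_fin _))) _ _ fun i => ?_
    simp [finCongr]
  have h2 : ∀ m, ∑ i, hG.eigenvalues i ^ m = ∑ v, (nLap G ^ m) v v := by
    intro m
    rw [← normLaplacian_eq_nLap]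
    change _ = Matrix.trace (normLaplacian G ^ m)
    conv_rhs => rw [hG.spectral_theorem, ← map_pow, Unitary.conjStarAlgAut_apply,
      Matrix.trace_mul_comm, ← mul_assoc]
    simp [Matrix.diagonal_pow, Matrix.trace]
  rw [h1]
  simp only [polyTrace, localEval, Polynomial.eval_eq_sum_range]
  rw [sum_comm, sum_comm (s := univ (α := Fin n))]
  simp_rw [← mul_sum, h2]
  congr!

theorem sum_abs_nLap_le {G : SimpleGraph V} {d : ℕ} (hd : ∀ v, #(nbr G v) ≤ d) (x : V) :
    ∑ y, |nLap G x y| ≤ d + 1 := by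
  have : ∑ y, |nLap G x y| = ∑ y ∈ insert x (nbr G x), |nLap G x y| := by
    symm
    refine sum_subset (subset_univ _) fun y _ hy => ?_
    rw [abs_eq_zero]
    by_contra h
    rcases nLap_ne_zero h with rfl | h
    · simp at hy
    · simp [h] at hy
  rw [this]
  calc _ ≤ ∑ y ∈ insert x (nbr G x), (1 : ℝ) := sum_le_sum fun y _ => abs_nLap_le_one G x y
    _ = (#(insert x (nbr G x)) : ℝ) := by simp
    _ ≤ (d + 1 : ℕ) := by
      exact_mod_cast (card_insert_le _ _).trans (Nat.add_le_add_right (hd x) 1)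
    _ = _ := by push_cast; ring

theorem sum_abs_nLap_pow_le {G : SimpleGraph V} {d : ℕ} (hd : ∀ v, #(nbr G v) ≤ d) (m : ℕ)
    (x : V) : ∑ y, |(nLap G ^ m) x y| ≤ (d + 1) ^ m := by
  induction m generalizing x with
  | zero => simp [Matrix.one_apply, apply_ite abs]
  | succ m ih =>
    calc ∑ y, |(nLap G ^ (m + 1)) x y| ≤ ∑ y, ∑ z, |nLap G x z| * |(nLap G ^ m) z y| := by
          refine sum_le_sum fun y _ => ?_
          rw [pow_succ', Matrix.mul_apply]
          refine (abs_sum_le_sum_abs _ _).trans_eq ?_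
          simp_rw [abs_mul]
      _ = ∑ z, |nLap G x z| * ∑ y, |(nLap G ^ m) z y| := by
        rw [sum_comm]; simp_rw [mul_sum]
      _ ≤ ∑ z, |nLap G x z| * (d + 1) ^ m :=
        sum_le_sum fun z _ => mul_le_mul_of_nonneg_left (ih z) (abs_nonneg _)
      _ ≤ (d + 1) * (d + 1) ^ m := by
        rw [← sum_mul]
        gcongr
        exact sum_abs_nLap_le hd x
      _ = _ := (pow_succ' _ _).symm

/-- A bound for `|localEval p G v|` in graphs of maximal degree at most `d`. -/
def evalBound (p : Polynomial ℝ) (d : ℕ) : ℝ :=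
  ∑ m ∈ range (p.natDegree + 1), |p.coeff m| * (d + 1) ^ m

theorem evalBound_nonneg (p : Polynomial ℝ) (d : ℕ) : 0 ≤ evalBound p d :=
  sum_nonneg fun _ _ => by positivity

theorem abs_localEval_le (p : Polynomial ℝ) {G : SimpleGraph V} {d : ℕ}
    (hd : ∀ v, #(nbr G v) ≤ d) (v : V) : |localEval p G v| ≤ evalBound p d := by
  refine (abs_sum_le_sum_abs _ _).trans (sum_le_sum fun m _ => ?_)
  rw [abs_mul]
  gcongr
  exact (single_le_sum (f := fun y => |(nLap G ^ m) v y|) (fun _ _ => abs_nonneg _)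
    (mem_univ v)).trans (sum_abs_nLap_pow_le hd m v)

/-- Read the eigenvector equation at a coordinate of largest modulus and use the bound on absolute
row sums. Any bound independent of `n` would do. -/
theorem abs_graphSpectrum_le {n : ℕ} {G : SimpleGraph (Fin n)} {d : ℕ}
    (hd : ∀ v, #(nbr G v) ≤ d) (i : Fin n) : |graphSpectrum G i| ≤ d + 1 := by
  have hG := normLaplacian_isHermitian G
  obtain ⟨j, hj⟩ : ∃ j, graphSpectrum G i = hG.eigenvalues j :=
    ⟨(Fintype.equivOfCardEq (Fintype.card_fin _)) (Fin.cast (Fintype.card_fin n).symm i), by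
      simp [graphSpectrum, Matrix.IsHermitian.eigenvalues]⟩
  rw [hj]
  set w : Fin n → ℝ := ⇑(hG.eigenvectorBasis j) with hw
  have hwne : w ≠ 0 := by
    intro h0
    apply hG.eigenvectorBasis.orthonormal.ne_zero j
    ext k
    exact congrFun h0 k
  have hmul : (nLap G).mulVec w = hG.eigenvalues j • w := by
    rw [← normLaplacian_eq_nLap]
    exact hG.mulVec_eigenvectorBasis j
  obtain ⟨k, -, hk⟩ := exists_max_image univ (fun k => |w k|) ⟨i, mem_univ i⟩
  have hkpos : 0 < |w k| := by
    rw [abs_pos]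
    intro h0
    apply hwne
    ext k'
    have := hk k' (mem_univ _)
    rw [h0, abs_zero] at this
    simpa using abs_nonpos_iff.1 this
  have h1 := congrFun hmul k
  simp only [Matrix.mulVec, dotProduct, Pi.smul_apply, smul_eq_mul] at h1
  have h2 : |hG.eigenvalues j| * |w k| ≤ (d + 1) * |w k| := by
    rw [← abs_mul, ← h1]
    calc _ ≤ ∑ x, |nLap G k x * w x| := abs_sum_le_sum_abs _ _
      _ ≤ ∑ x, |nLap G k x| * |w k| := sum_le_sum fun x _ => by
        rw [abs_mul]
        exact mul_le_mul_of_nonneg_left (hk x (mem_univ _)) (abs_nonneg _)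
      _ ≤ _ := by
        rw [← sum_mul]
        gcongr
        exact sum_abs_nLap_le hd k
  exact le_of_mul_le_mul_right h2 hkpos

theorem antitone_graphSpectrum {n : ℕ} (G : SimpleGraph (Fin n)) : Antitone (graphSpectrum G) := by
  intro i j hij
  exact (normLaplacian_isHermitian G).eigenvalues₀_antitone (by simpa using hij)

/-- The `ℓ₁`-distance of the spectra of two bounded degree graphs is determined, up to a small
error, by the traces of finitely many polynomials of the normalized Laplacians. -/
theorem exists_trace_tests (d : ℕ) {γ : ℝ} (hγ : 0 < γ) :
    ∃ (N : ℕ) (p : ℕ → Polynomial ℝ), ∀ (n : ℕ) (G H : SimpleGraph (Fin n)),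
      (∀ v, #(nbr G v) ≤ d) → (∀ v, #(nbr H v) ≤ d) →
      |∑ i, |graphSpectrum G i - graphSpectrum H i| -
        (∑ l ∈ range N, |polyTrace (p l) G - polyTrace (p l) H|)| ≤ γ * n := by
  obtain ⟨N, p, h⟩ := exists_polynomial_tests (B := d + 1) (by positivity) hγ
  refine ⟨N, p, fun n G H hG hH => ?_⟩
  simpa only [sum_eval_graphSpectrum] using h n _ _ (antitone_graphSpectrum G)
    (antitone_graphSpectrum H) (abs_graphSpectrum_le hG) (abs_graphSpectrum_le hH)

theorem localEval_eq_of_color_eq {W : Type} [Fintype W] {p : Polynomial ℝ} {g : ℕ}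
    (hp : p.natDegree ≤ g) {G : SimpleGraph V}
    {H : SimpleGraph W} (hG : (g : ℕ∞) < G.egirth) (hH : (g : ℕ∞) < H.egirth) {v : V} {w : W}
    (h : color G (g + 1) v = color H (g + 1) w) : localEval p G v = localEval p H w := by
  refine sum_congr rfl fun m hm => ?_
  have hm : m ≤ g := by have := mem_range.1 hm; omega
  have hm' : (m : ℕ∞) ≤ g := by exact_mod_cast hm
  rw [nLap_pow_apply_eq_of_color_eq (hm'.trans_lt hG) (hm'.trans_lt hH)
    (color_eq_of_le (by omega) h)]

end Traces

/-! ### Swapping two distant edges preserves large girth -/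

section Swap

variable {V : Type}

open SimpleGraph in
theorem exists_eq_append_cons_of_mem_edges {G : SimpleGraph V} {a b : V} {p : G.Walk a b}
    {e : Sym2 V} (he : e ∈ p.edges) : ∃ (x y : V) (h : G.Adj x y) (q : G.Walk a x)
      (r : G.Walk y b), s(x, y) = e ∧ p = q.append (.cons h r) := by
  induction p with
  | nil => simp at he
  | cons h p ih =>
    rw [Walk.edges_cons, List.mem_cons] at he
    rcases he with rfl | he
    · exact ⟨_, _, h, .nil, p, rfl, rfl⟩
    · obtain ⟨x, y, h', q, r, h1, rfl⟩ := ih he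
      exact ⟨x, y, h', .cons h q, r, h1, rfl⟩

/-- A trail through a given edge, cut open at that edge. -/
theorem exists_walks_of_mem_edges {G : SimpleGraph V} {a b x y : V} {p : G.Walk a b}
    (hp : p.edges.Nodup) (he : s(x, y) ∈ p.edges) :
    ∃ x' y', s(x', y') = s(x, y) ∧ ∃ (q : G.Walk a x') (r : G.Walk y' b),
      q.length + r.length + 1 = p.length ∧ (∀ e ∈ q.edges, e ∈ p.edges) ∧
      (∀ e ∈ r.edges, e ∈ p.edges) ∧ s(x, y) ∉ q.edges ∧ s(x, y) ∉ r.edges ∧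
      List.Disjoint q.edges r.edges ∧ q.edges.Nodup ∧ r.edges.Nodup := by
  obtain ⟨x', y', h, q, r, hxy, rfl⟩ := exists_eq_append_cons_of_mem_edges he
  refine ⟨x', y', hxy, q, r, ?_⟩
  simp only [SimpleGraph.Walk.edges_append, SimpleGraph.Walk.edges_cons, hxy,
    List.nodup_append, List.nodup_cons, List.mem_cons, SimpleGraph.Walk.length_append,
    SimpleGraph.Walk.length_cons, List.mem_append] at hp ⊢
  refine ⟨by omega, fun e he => .inl he, fun e he => .inr (.inr he), fun h' => ?_, hp.2.1.1,
    fun e h1 h2 => ?_, hp.1, hp.2.1.2⟩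
  · exact hp.2.2 _ h' _ (.inl rfl) rfl
  · exact hp.2.2 _ h1 _ (.inr h2) rfl

/-- Cut the closed trail open at the edge and join the two pieces at `a`; the orientation of the
edge is adjusted by reversal. -/
theorem exists_walk_of_mem_edges_closed {G : SimpleGraph V} {a x y : V} {p : G.Walk a a}
    (hp : p.edges.Nodup) (he : s(x, y) ∈ p.edges) :
    ∃ r : G.Walk y x, r.length + 1 = p.length ∧ (∀ e ∈ r.edges, e ∈ p.edges) ∧
      s(x, y) ∉ r.edges ∧ r.edges.Nodup := by
  obtain ⟨x', y', hxy, q, r, h1, h2, h3, h4, h5, h6, h7, h8⟩ := exists_walks_of_mem_edges hp he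
  have key : ∃ r : G.Walk y' x', r.length + 1 = p.length ∧ (∀ e ∈ r.edges, e ∈ p.edges) ∧
      s(x, y) ∉ r.edges ∧ r.edges.Nodup := by
    refine ⟨r.append q, ?_, ?_, ?_, ?_⟩
    · rw [SimpleGraph.Walk.length_append]; omega
    · intro e he
      rw [SimpleGraph.Walk.edges_append, List.mem_append] at he
      exact he.elim (h3 e) (h2 e)
    · rw [SimpleGraph.Walk.edges_append, List.mem_append]
      tauto
    · rw [SimpleGraph.Walk.edges_append]
      exact h8.append h7 h6.symm
  rcases Sym2.eq_iff.1 hxy with ⟨rfl, rfl⟩ | ⟨rfl, rfl⟩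
  · exact key
  · obtain ⟨r, k1, k2, k3, k4⟩ := key
    exact ⟨r.reverse, by simpa using k1, by simpa using k2, by simpa using k3, by simpa using k4⟩

/-- Replace the edges `uv` and `u'v'` by `uu'` and `vv'`. -/
def swap (G : SimpleGraph V) (u v u' v' : V) : SimpleGraph V where
  Adj x y := (G.Adj x y ∧ s(x, y) ≠ s(u, v) ∧ s(x, y) ≠ s(u', v')) ∨
    ((s(x, y) = s(u, u') ∨ s(x, y) = s(v, v')) ∧ x ≠ y)
  symm := ⟨by
    intro x y h
    rw [Sym2.eq_swap (a := y) (b := x), G.adj_comm y x, ne_comm (a := y)]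
    exact h⟩
  loopless := ⟨by
    intro x h
    simp at h⟩

/-- The edges `uv` and `u'v'` of `G` have distance larger than `L`. -/
structure FarEdges (G : SimpleGraph V) (L : ℕ) (u v u' v' : V) : Prop where
  left : G.Adj u v
  right : G.Adj u' v'
  far : ∀ a b, a = u ∨ a = v → b = u' ∨ b = v' → ∀ p : G.Walk a b, L < p.length

variable {G : SimpleGraph V} {L : ℕ} {u v u' v' : V}

theorem FarEdges.not_adj_or_eq (h : FarEdges G L u v u' v') (hL : 1 ≤ L) {a b : V}
    (ha : a = u ∨ a = v) (hb : b = u' ∨ b = v') : a ≠ b ∧ ¬ G.Adj a b := by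
  constructor
  · rintro rfl
    simpa using h.far a a ha hb .nil
  · intro hab
    have := h.far a b ha hb hab.toWalk
    simp at this
    omega

theorem exists_walk_of_swap {x y : V} (q : (swap G u v u' v').Walk x y)
    (h1 : s(u, u') ∉ q.edges) (h2 : s(v, v') ∉ q.edges) :
    ∃ r : G.Walk x y, r.length = q.length ∧ s(u, v) ∉ r.edges ∧ r.edges = q.edges := by
  have key : ∀ e ∈ q.edges, e ∈ G.edgeSet ∧ e ≠ s(u, v) := by
    intro e he
    have he' := q.edges_subset_edgeSet he
    induction e with
    | _ a b =>
    have h3 : s(a, b) ≠ s(u, u') := fun h => h1 (h ▸ he)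
    have h4 : s(a, b) ≠ s(v, v') := fun h => h2 (h ▸ he)
    rw [SimpleGraph.mem_edgeSet] at he' ⊢
    rcases he' with h | h
    · exact ⟨h.1, h.2.1⟩
    · exact absurd h.1 (by tauto)
  refine ⟨q.transfer G fun e he => (key e he).1, by simp, ?_, by simp⟩
  rw [SimpleGraph.Walk.edges_transfer]
  exact fun h => (key _ h).2 rfl

/-- Consider a short cycle of the new graph. With no new edge it is a cycle of `G`. With one new
edge, the rest is a short walk of `G` between the two old edges, which are far apart. With both, a
remaining piece either joins the old edges again or joins `v` to `u` without using `uv`, giving a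
short cycle of `G` together with `uv`. -/
theorem lt_egirth_swap (h : FarEdges G L u v u' v') (hG : (L : ℕ∞) < G.egirth) :
    (L : ℕ∞) < (swap G u v u' v').egirth := by
  have hLt : ∀ m : ℕ∞, (L : ℕ∞) < m ↔ ((L + 1 : ℕ) : ℕ∞) ≤ m := by
    intro m
    rw [Nat.cast_add, Nat.cast_one, ENat.add_one_le_iff (ENat.natCast_ne_top L)]
  rw [hLt, SimpleGraph.le_egirth]
  intro a w hw
  by_contra hlen
  have hlen : w.length ≤ L := by
    have : ¬ (L + 1 ≤ w.length) := by exact_mod_cast hlen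
    omega
  have hnd : w.edges.Nodup := hw.edges_nodup
  by_cases h1 : s(u, u') ∈ w.edges
  · obtain ⟨r, hr, hrw, hru, hrn⟩ := exists_walk_of_mem_edges_closed hnd h1
    by_cases h2 : s(v, v') ∈ r.edges
    · obtain ⟨x, y, hxy, q, q', k1, k2, k3, k4, k5, -⟩ := exists_walks_of_mem_edges hrn h2
      rcases Sym2.eq_iff.1 hxy with ⟨rfl, rfl⟩ | ⟨rfl, rfl⟩
      · obtain ⟨t, ht, -⟩ := exists_walk_of_swap q (fun h => hru (k2 _ h)) k4
        have := h.far x u' (.inr rfl) (.inl rfl) t.reverse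
        rw [SimpleGraph.Walk.length_reverse] at this
        omega
      · obtain ⟨t, ht, ht', -⟩ := exists_walk_of_swap q' (fun h => hru (k3 _ h)) k5
        have := egirth_le_of_walk h.left t ht'
        have := hG.trans_le this
        have : L < t.length + 1 := by exact_mod_cast this
        omega
    · obtain ⟨t, ht, -⟩ := exists_walk_of_swap r hru h2
      have := h.far u u' (.inl rfl) (.inl rfl) t.reverse
      rw [SimpleGraph.Walk.length_reverse] at this
      omega
  · by_cases h2 : s(v, v') ∈ w.edges
    · obtain ⟨r, hr, hrw, hru, hrn⟩ := exists_walk_of_mem_edges_closed hnd h2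
      obtain ⟨t, ht, -⟩ := exists_walk_of_swap r (fun h => h1 (hrw _ h)) hru
      have := h.far v v' (.inr rfl) (.inr rfl) t.reverse
      rw [SimpleGraph.Walk.length_reverse] at this
      omega
    · obtain ⟨t, -, -, ht⟩ := exists_walk_of_swap w h1 h2
      have hw' := hw.transfer (H := G) fun e he => t.edges_subset_edgeSet (ht ▸ he)
      have := hG.trans_le (SimpleGraph.egirth_le_length hw')
      rw [SimpleGraph.Walk.length_transfer] at this
      have : L < w.length := by exact_mod_cast this
      omega

end Swap

/-! ### Swaps preserve colours and reduce the boundary of a set -/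

section SwapColors

variable {V : Type} [Fintype V] {G : SimpleGraph V} {L : ℕ} {u v u' v' : V}

theorem map_insert_erase {α β : Type*} {s : Finset α} {a b : α} (ha : a ∈ s) (hb : b ∉ s)
    {f : α → β} (hf : f a = f b) : (insert b (s.erase a)).val.map f = s.val.map f := by
  rw [insert_val_of_notMem (fun h => hb (mem_of_mem_erase h)), Multiset.map_cons, ← hf,
    ← Multiset.map_cons, erase_val, Multiset.cons_erase ha]

/-- Each of the four vertices loses one neighbour and gains one with the same `f`-value: `u` trades
`v` for `u'`, and `v` trades `u` for `v'`. The distance guarantees that the gained neighbour is new.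
-/
theorem map_nbr_swap (h : FarEdges G L u v u' v') (hL : 1 ≤ L) {β : Type*} {f : V → β}
    (h1 : f u = f v') (h2 : f v = f u') (x : V) :
    (nbr (swap G u v u' v') x).val.map f = (nbr G x).val.map f := by
  obtain ⟨n1, n2⟩ := h.not_adj_or_eq hL (a := u) (b := u') (.inl rfl) (.inl rfl)
  obtain ⟨n3, n4⟩ := h.not_adj_or_eq hL (a := u) (b := v') (.inl rfl) (.inr rfl)
  obtain ⟨n5, n6⟩ := h.not_adj_or_eq hL (a := v) (b := u') (.inr rfl) (.inl rfl)
  obtain ⟨n7, n8⟩ := h.not_adj_or_eq hL (a := v) (b := v') (.inr rfl) (.inr rfl)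
  have e1 := h.left
  have e2 := h.right
  have e3 := e1.ne
  have e4 := e2.ne
  by_cases hu : x = u
  · subst hu
    rw [← map_insert_erase (mem_nbr.2 e1) (fun h => n2 (mem_nbr.1 h)) h2]
    congr 2
    ext y
    simp only [mem_nbr, swap, Sym2.eq_iff, mem_insert, mem_erase]
    grind
  by_cases hv : x = v
  · subst hv
    rw [← map_insert_erase (mem_nbr.2 e1.symm) (fun h => n8 (mem_nbr.1 h)) h1]
    congr 2
    ext y
    simp only [mem_nbr, swap, Sym2.eq_iff, mem_insert, mem_erase]
    grind
  by_cases hu' : x = u'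
  · subst hu'
    rw [← map_insert_erase (mem_nbr.2 e2) (fun h => n2 (mem_nbr.1 h).symm) h1.symm]
    congr 2
    ext y
    simp only [mem_nbr, swap, Sym2.eq_iff, mem_insert, mem_erase]
    grind
  by_cases hv' : x = v'
  · subst hv'
    rw [← map_insert_erase (mem_nbr.2 e2.symm) (fun h => n8 (mem_nbr.1 h).symm) h2.symm]
    congr 2
    ext y
    simp only [mem_nbr, swap, Sym2.eq_iff, mem_insert, mem_erase]
    grind
  · congr 2
    ext y
    simp only [mem_nbr, swap, Sym2.eq_iff]
    grind

theorem color_swap (h : FarEdges G L u v u' v') (hL : 1 ≤ L) {k : ℕ}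
    (h1 : color G k u = color G k v') (h2 : color G k v = color G k u') {j : ℕ} :
    ∀ (_ : j ≤ k + 1) (x : V), color (swap G u v u' v') j x = color G j x := by
  induction j with
  | zero => intros; rfl
  | succ j ih =>
    intro hj x
    rw [color_succ_eq_iff, funext (ih (by omega))]
    exact map_nbr_swap h hL (color_eq_of_le (by omega) h1) (color_eq_of_le (by omega) h2) x

/-- The vertices at distance at most `R` from `x`. -/
def ball (G : SimpleGraph V) (R : ℕ) (x : V) : Finset V :=
  univ.filter fun y => ∃ p : G.Walk x y, p.length ≤ R

theorem card_ball_le {d : ℕ} (hd : ∀ v, #(nbr G v) ≤ d) (R : ℕ) (x : V) :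
    #(ball G R x) ≤ (d + 1) ^ R := by
  induction R generalizing x with
  | zero =>
    rw [pow_zero, card_le_one]
    have : ∀ y ∈ ball G 0 x, x = y := by
      intro y hy
      obtain ⟨p, hp⟩ := (mem_filter.1 hy).2
      exact SimpleGraph.Walk.eq_of_length_eq_zero (Nat.le_zero.1 hp)
    intro y hy z hz
    rw [← this y hy, ← this z hz]
  | succ R ih =>
    have hsub : ball G (R + 1) x ⊆ (insert x (nbr G x)).biUnion (ball G R) := by
      intro y hy
      obtain ⟨p, hp⟩ := (mem_filter.1 hy).2
      rw [mem_biUnion]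
      cases p with
      | nil => exact ⟨x, mem_insert_self _ _, mem_filter.2 ⟨mem_univ _, .nil, by simp⟩⟩
      | cons h p =>
        exact ⟨_, mem_insert_of_mem (mem_nbr.2 h), mem_filter.2 ⟨mem_univ _, p, by
          simpa using hp⟩⟩
    calc _ ≤ _ := card_le_card hsub
      _ ≤ #(insert x (nbr G x)) * (d + 1) ^ R := card_biUnion_le_card_mul _ _ _ fun y _ => ih y
      _ ≤ (d + 1) * (d + 1) ^ R := by
        gcongr
        exact (card_insert_le _ _).trans (Nat.add_le_add_right (hd x) 1)
      _ = _ := (pow_succ' _ _).symm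

/-- The edges of `G` between `U` and its complement, directed away from `U`. -/
def crossing (G : SimpleGraph V) (U : Finset V) : Finset (V × V) :=
  univ.filter fun e => e.1 ∈ U ∧ e.2 ∉ U ∧ G.Adj e.1 e.2

@[simp] theorem mem_crossing {U : Finset V} {e : V × V} :
    e ∈ crossing G U ↔ e.1 ∈ U ∧ e.2 ∉ U ∧ G.Adj e.1 e.2 := by
  simp [crossing]

/-- The new edge `uu'` lies inside `U` and `vv'` outside, while both removed edges cross. -/
theorem card_crossing_swap (h : FarEdges G L u v u' v') (hL : 1 ≤ L) {U : Finset V} (hu : u ∈ U)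
    (hv : v ∉ U) (hu' : u' ∈ U) (hv' : v' ∉ U) :
    #(crossing (swap G u v u' v') U) + 2 ≤ #(crossing G U) := by
  have hne : u ≠ u' := (h.not_adj_or_eq hL (.inl rfl) (.inl rfl)).1
  have hsub : crossing (swap G u v u' v') U ⊆ ((crossing G U).erase (u, v)).erase (u', v') := by
    rintro ⟨x, y⟩ hxy
    simp only [mem_crossing, swap, Sym2.eq_iff, mem_erase, Prod.mk.injEq, ne_eq] at hxy ⊢
    grind
  have h1 : (u, v) ∈ crossing G U := by simp [hu, hv, h.left]
  have h2 : (u', v') ∈ (crossing G U).erase (u, v) := by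
    simp [hu', hv', h.right, hne.symm]
  have := card_le_card hsub
  rw [card_erase_of_mem h2, card_erase_of_mem h1] at this
  have h3 := card_pos.2 ⟨_, h2⟩
  rw [card_erase_of_mem h1] at h3
  omega

theorem ncard_symmDiff_swap (G₀ : SimpleGraph V) (u v u' v' : V) :
    (symmDiff G₀.edgeSet (swap G u v u' v').edgeSet).ncard ≤
      (symmDiff G₀.edgeSet G.edgeSet).ncard + 4 := by
  have hsub : symmDiff G₀.edgeSet (swap G u v u' v').edgeSet ⊆
      symmDiff G₀.edgeSet G.edgeSet ∪ (({s(u, v), s(u', v'), s(u, u'), s(v, v')} :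
        Finset (Sym2 V)) : Set (Sym2 V)) := by
    intro e he
    induction e with
    | _ x y =>
    simp only [Set.mem_symmDiff, SimpleGraph.mem_edgeSet, swap, Set.mem_union, coe_insert,
      coe_singleton, Set.mem_insert_iff, Set.mem_singleton_iff] at he ⊢
    tauto
  calc _ ≤ _ := Set.ncard_le_ncard hsub (Set.toFinite _)
    _ ≤ _ := Set.ncard_union_le _ _
    _ ≤ _ := by
      rw [Set.ncard_coe_finset]
      gcongr
      exact card_le_four

/-- By swaps the number of edges leaving `U` can be reduced, preserving colours and girth, until
edges of opposite colours are never far apart. -/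
theorem exists_reduced (G₀ : SimpleGraph V) (U : Finset V) (k : ℕ) (hL : 1 ≤ L)
    (hg : (L : ℕ∞) < G₀.egirth) : ∃ G : SimpleGraph V,
      (∀ j ≤ k + 1, ∀ x, color G j x = color G₀ j x) ∧ (L : ℕ∞) < G.egirth ∧
      (symmDiff G₀.edgeSet G.edgeSet).ncard + 2 * #(crossing G U) ≤ 2 * #(crossing G₀ U) ∧
      ∀ e ∈ crossing G U, ∀ e' ∈ crossing G U, color G k e.1 = color G k e'.2 →
        color G k e.2 = color G k e'.1 → e'.1 ∈ ball G (L + 2) e.1 := by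
  -- A swap alters at most four edges and removes at least two crossing ones, so the third condition
  -- survives it. In a member with fewest crossing edges no swap is possible.
  let good : Set (SimpleGraph V) := {G | (∀ j ≤ k + 1, ∀ x, color G j x = color G₀ j x) ∧
    (L : ℕ∞) < G.egirth ∧
    (symmDiff G₀.edgeSet G.edgeSet).ncard + 2 * #(crossing G U) ≤ 2 * #(crossing G₀ U)}
  have hgood : G₀ ∈ good := ⟨fun _ _ _ => rfl, hg, by simp⟩
  obtain ⟨G, ⟨hG1, hG2, hG3⟩, hmin⟩ :=
    (Set.toFinite good).exists_minimalFor (fun G => #(crossing G U)) _ ⟨G₀, hgood⟩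
  refine ⟨G, hG1, hG2, hG3, ?_⟩
  rintro ⟨u, v⟩ he ⟨u', v'⟩ he' h1 h2
  simp only [mem_crossing] at he he' h1 h2 ⊢
  by_contra hball
  have hfar : FarEdges G L u v u' v' := by
    refine ⟨he.2.2, he'.2.2, fun a b ha hb p => ?_⟩
    by_contra hp
    apply hball
    -- A walk of length at most `L` between the edges grows by at most one step at each end to join
    -- `u` to `u'`; hence the radius `L + 2`.
    obtain ⟨q, hq⟩ : ∃ q : G.Walk u a, q.length ≤ 1 := by
      rcases ha with rfl | rfl
      · exact ⟨.nil, by simp⟩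
      · exact ⟨he.2.2.toWalk, by simp⟩
    obtain ⟨r, hr⟩ : ∃ r : G.Walk b u', r.length ≤ 1 := by
      rcases hb with rfl | rfl
      · exact ⟨.nil, by simp⟩
      · exact ⟨he'.2.2.symm.toWalk, by simp⟩
    refine mem_filter.2 ⟨mem_univ _, (q.append p).append r, ?_⟩
    simp only [SimpleGraph.Walk.length_append]
    omega
  have hc := card_crossing_swap hfar hL he.1 he.2.1 he'.1 he'.2.1
  have hs := ncard_symmDiff_swap (G := G) G₀ u v u' v'
  have := @hmin (swap G u v u' v') ⟨fun j hj x => (color_swap hfar hL h1 h2 hj x).trans (hG1 j hj x),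
    lt_egirth_swap hfar hG2, by omega⟩ (by dsimp only; omega)
  dsimp only at this
  omega

end SwapColors

/-! ### Proportional sets and their crossing edges -/

section Proportional

variable {V : Type} [Fintype V]

/-- The set `U` contains a proportion of about `ρ` of each colour class: the sum over `U` of a
function of the colour is `ρ` times its sum over all vertices, up to a bounded error. -/
def Proportional (c : V → ℕ) (ρ κ : ℝ) (U : Finset V) : Prop :=
  ∀ (f : V → ℝ) (C : ℝ), 0 ≤ C → (∀ x y, c x = c y → f x = f y) → (∀ x, |f x| ≤ C) →
    |∑ x ∈ U, f x - ρ * ∑ x, f x| ≤ κ * C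

/-- Take a proportion `ρ` of every colour class, rounded down; the rounding costs at most `C` per
colour. -/
theorem exists_proportional (c : V → ℕ) (K : Finset ℕ) (hK : ∀ x, c x ∈ K) {ρ : ℝ} (hρ : 0 ≤ ρ)
    (hρ1 : ρ ≤ 1) : ∃ U : Finset V, Proportional c ρ #K U := by
  have hex : ∀ a, ∃ T ⊆ univ.filter (fun x => c x = a),
      #T = ⌊ρ * #(univ.filter fun x => c x = a)⌋₊ := fun a => by
    apply exists_subset_card_eq
    apply Nat.floor_le_of_le
    exact mul_le_of_le_one_left (Nat.cast_nonneg _) hρ1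
  choose T hT hTc using hex
  have hTm : ∀ a x, x ∈ T a → c x = a := fun a x hx => (mem_filter.1 (hT a hx)).2
  refine ⟨K.biUnion T, fun f C hC0 hf hC => ?_⟩
  have h1 : ∑ x ∈ K.biUnion T, f x = ∑ a ∈ K, ∑ x ∈ T a, f x := by
    rw [sum_biUnion]
    intro a _ b _ hab
    rw [Function.onFun, disjoint_left]
    intro x hx hx'
    exact hab ((hTm a x hx).symm.trans (hTm b x hx'))
  have h2 : ∑ x, f x = ∑ a ∈ K, ∑ x ∈ univ.filter (fun x => c x = a), f x :=
    (sum_fiberwise_of_maps_to (fun x _ => hK x) f).symm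
  rw [h1, h2, mul_sum, ← sum_sub_distrib]
  refine (abs_sum_le_sum_abs _ _).trans ?_
  rw [← nsmul_eq_mul, ← sum_const]
  refine sum_le_sum fun a _ => ?_
  by_cases hne : (univ.filter fun x => c x = a).Nonempty
  · obtain ⟨z, hz⟩ := hne
    have hz := (mem_filter.1 hz).2
    have hfz : ∀ x, c x = a → f x = f z := fun x hx => hf x z (hx.trans hz.symm)
    rw [sum_congr rfl fun x hx => hfz x (hTm a x hx),
      sum_congr rfl fun x hx => hfz x (mem_filter.1 hx).2, sum_const, sum_const, hTc,
      nsmul_eq_mul, nsmul_eq_mul, ← mul_assoc, ← sub_mul, abs_mul]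
    calc _ ≤ 1 * |f z| := by
          gcongr
          have hnn : 0 ≤ ρ * (#(univ.filter fun x => c x = a) : ℝ) := by positivity
          have := Nat.floor_le hnn
          have := Nat.lt_floor_add_one (ρ * (#(univ.filter fun x => c x = a) : ℝ))
          rw [abs_le]
          constructor <;> linarith
      _ ≤ C := by rw [one_mul]; exact hC z
  · rw [not_nonempty_iff_eq_empty] at hne
    have : T a = ∅ := subset_empty.1 (hne ▸ hT a)
    rw [this, hne]
    simpa using hC0


/-- The directed edges of type `(a, b)` starting in `U` number about `ρ` times all edges of that
type. Reversal shows that types `(a, b)` and `(b, a)` are equally frequent in `G` and inside `U`, so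
crossing edges of the two types are balanced up to `2 * (κ * d)`. If one of type `(a, b)` exists,
`hred` confines all those of type `(b, a)` to a ball; if none exists, the balance bounds them. -/
theorem card_crossing_le {G : SimpleGraph V} {d L k : ℕ} (hd : ∀ v, #(nbr G v) ≤ d) {U : Finset V}
    {ρ κ : ℝ} (hκ : 0 ≤ κ) (hU : Proportional (color G (k + 1)) ρ κ U) {K : Finset ℕ}
    (hK : ∀ x, color G k x ∈ K)
    (hred : ∀ e ∈ crossing G U, ∀ e' ∈ crossing G U, color G k e.1 = color G k e'.2 →
        color G k e.2 = color G k e'.1 → e'.1 ∈ ball G (L + 2) e.1) :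
    (#(crossing G U) : ℝ) ≤ #K ^ 2 * (((d + 1) ^ (L + 3)) ^ 2 + 2 * (κ * d)) := by
  let typed (a b : ℕ) (e : V × V) : Prop :=
    G.Adj e.1 e.2 ∧ color G k e.1 = a ∧ color G k e.2 = b
  let X (a b : ℕ) : Finset (V × V) := univ.filter fun e => typed a b e ∧ e.1 ∈ U ∧ e.2 ∉ U
  let Z (a b : ℕ) : Finset (V × V) := univ.filter fun e => typed a b e ∧ e.1 ∈ U ∧ e.2 ∈ U
  let T (a b : ℕ) : Finset (V × V) := univ.filter fun e => typed a b e
  let f (a b : ℕ) (x : V) : ℝ :=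
    if color G k x = a then ∑ y ∈ nbr G x, (if color G k y = b then 1 else 0) else 0
  have hswap : ∀ a b e, typed a b e ↔ typed b a e.swap := fun a b e => by
    simp only [typed, Prod.fst_swap, Prod.snd_swap, G.adj_comm e.2]
    tauto
  have hZ : ∀ a b, #(Z a b) = #(Z b a) := fun a b => by
    refine card_bij (fun e _ => e.swap) (fun e he => ?_) (fun _ _ _ _ => Prod.swap_injective.eq_iff.1)
      (fun e he => ⟨e.swap, ?_, Prod.swap_swap e⟩) <;>
    · simp only [Z, mem_filter, mem_univ, true_and, Prod.fst_swap, Prod.snd_swap] at he ⊢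
      rw [← hswap]
      tauto
  have hT : ∀ a b, #(T a b) = #(T b a) := fun a b => by
    refine card_bij (fun e _ => e.swap) (fun e he => ?_) (fun _ _ _ _ => Prod.swap_injective.eq_iff.1)
      (fun e he => ⟨e.swap, ?_, Prod.swap_swap e⟩) <;>
    · simp only [T, mem_filter, mem_univ, true_and] at he ⊢
      rw [← hswap]
      tauto
  have hf : ∀ a b x, f a b x = ∑ y, if typed a b (x, y) then 1 else 0 := fun a b x => by
    simp only [f, nbr, sum_filter, typed]
    split_ifs with h
    · refine sum_congr rfl fun y _ => ?_
      by_cases h1 : G.Adj x y <;> simp [h, h1]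
    · simp [h]
  have hfT : ∀ a b, ∑ x, f a b x = #(T a b) := fun a b => by
    rw [sum_congr rfl fun x _ => hf a b x, ← Fintype.sum_prod_type', sum_boole]
  have hfU : ∀ a b, ∑ x ∈ U, f a b x = #(X a b) + #(Z a b) := fun a b => by
    have : #(X a b) + #(Z a b) = #(univ.filter fun e : V × V => typed a b e ∧ e.1 ∈ U) := by
      rw [← card_union_of_disjoint]
      · congr 1
        ext e
        simp only [X, Z, mem_union, mem_filter, mem_univ, true_and]
        tauto
      · rw [disjoint_left]
        intro e h1 h2
        simp only [X, Z, mem_filter, mem_univ, true_and] at h1 h2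
        tauto
    rw [← Nat.cast_add, this, sum_congr rfl fun x _ => hf a b x,
      ← sum_boole (R := ℝ), Fintype.sum_prod_type, ← sum_filter_add_sum_filter_not univ (· ∈ U)]
    simp only [filter_mem_eq_inter, univ_inter]
    rw [sum_eq_zero (s := univ.filter fun x => x ∉ U), add_zero]
    · refine sum_congr rfl fun x hx => sum_congr rfl fun y _ => ?_
      simp [hx]
    · intro x hx
      simp [(mem_filter.1 hx).2]
  -- Proportionality is applied to the number of neighbours of colour `b` of a vertex of colour `a`;
  -- this needs colours of level `k + 1`.
  have hbal : ∀ a b, |(#(X a b) : ℝ) - #(X b a)| ≤ 2 * (κ * d) := fun a b => by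
    have key : ∀ a b, |(#(X a b) : ℝ) + #(Z a b) - ρ * #(T a b)| ≤ κ * d := fun a b => by
      rw [← hfU, ← hfT]
      refine hU _ d (Nat.cast_nonneg d) (fun x y hxy => ?_) (fun x => ?_)
      · simp only [f, color_eq_of_succ hxy]
        split_ifs
        · refine sum_nbr_eq_of_color_eq hxy fun z _ w _ h => ?_
          rw [h]
        · rfl
      · simp only [f]
        split_ifs
        · rw [sum_boole, Nat.abs_cast]
          exact_mod_cast (card_filter_le _ _).trans (hd x)
        · simp
    have h1 := abs_le.1 (key a b)
    have h2 := abs_le.1 (key b a)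
    rw [hZ b a, hT b a] at h2
    rw [abs_le]
    constructor <;> linarith
  have hX : ∀ a b, (#(X b a) : ℝ) ≤ ((d + 1) ^ (L + 3)) ^ 2 + 2 * (κ * d) := fun a b => by
    rcases (X a b).eq_empty_or_nonempty with h | ⟨e, he⟩
    · have h1 := abs_le.1 (hbal a b)
      rw [h, card_empty, Nat.cast_zero] at h1
      have : (0 : ℝ) ≤ ((d + 1) ^ (L + 3)) ^ 2 := by positivity
      linarith
    · have hsub : X b a ⊆ ball G (L + 3) e.1 ×ˢ ball G (L + 3) e.1 := by
        intro e' he'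
        simp only [X, typed, mem_filter, mem_univ, true_and] at he he'
        have h1 := hred e (by simp [he]) e' (by simp [he']) (by simp [he, he']) (by simp [he, he'])
        obtain ⟨p, hp⟩ := (mem_filter.1 h1).2
        rw [mem_product]
        refine ⟨mem_filter.2 ⟨mem_univ _, p, by omega⟩,
          mem_filter.2 ⟨mem_univ _, p.concat he'.1.1, ?_⟩⟩
        rw [SimpleGraph.Walk.length_concat]
        omega
      have h1 := card_le_card hsub
      rw [card_product, ← sq] at h1
      have h2 : #(X b a) ≤ ((d + 1) ^ (L + 3)) ^ 2 :=
        h1.trans (Nat.pow_le_pow_left (card_ball_le hd _ _) 2)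
      have h3 : (#(X b a) : ℝ) ≤ ((d + 1) ^ (L + 3)) ^ 2 := by exact_mod_cast h2
      have : 0 ≤ κ * d := by positivity
      linarith
  have hsub : crossing G U ⊆ (K ×ˢ K).biUnion fun ab => X ab.2 ab.1 := by
    intro e he
    rw [mem_crossing] at he
    rw [mem_biUnion]
    exact ⟨(color G k e.2, color G k e.1), mem_product.2 ⟨hK _, hK _⟩,
      mem_filter.2 ⟨mem_univ _, ⟨he.2.2, rfl, rfl⟩, he.1, he.2.1⟩⟩
  calc (#(crossing G U) : ℝ) ≤ ∑ ab ∈ K ×ˢ K, (#(X ab.2 ab.1) : ℝ) := by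
        exact_mod_cast (card_le_card hsub).trans card_biUnion_le
    _ ≤ ∑ ab ∈ K ×ˢ K, (((d + 1) ^ (L + 3)) ^ 2 + 2 * (κ * d)) := sum_le_sum fun ab _ => hX _ _
    _ = _ := by
      rw [sum_const, card_product, nsmul_eq_mul]
      push_cast
      ring

end Proportional

/-! ### Stability of polynomial traces under few edge changes -/

section Perturbation

variable {V : Type} [Fintype V] {G H : SimpleGraph V} {d : ℕ}

/-- Telescope `A ^ (m + 1) - B ^ (m + 1) = A * (A ^ m - B ^ m) + (A - B) * B ^ m` in the entrywise
`ℓ₁`-norm; by symmetry the bound on absolute row sums also bounds column sums. -/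
theorem sum_abs_nLap_pow_sub_le (hG : ∀ v, #(nbr G v) ≤ d) (hH : ∀ v, #(nbr H v) ≤ d) (m : ℕ) :
    ∑ x, ∑ y, |(nLap G ^ m - nLap H ^ m) x y| ≤
      m * (d + 1) ^ m * ∑ x, ∑ y, |(nLap G - nLap H) x y| := by
  set s := ∑ x, ∑ y, |(nLap G - nLap H) x y| with hs
  have hs0 : 0 ≤ s := sum_nonneg fun _ _ => sum_nonneg fun _ _ => abs_nonneg _
  have hmul : ∀ (A B : Matrix V V ℝ) x y, |(A * B) x y| ≤ ∑ z, |A x z| * |B z y| := by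
    intro A B x y
    rw [Matrix.mul_apply]
    refine (abs_sum_le_sum_abs _ _).trans_eq ?_
    simp_rw [abs_mul]
  induction m with
  | zero => simp
  | succ m ih =>
    have hsplit : nLap G ^ (m + 1) - nLap H ^ (m + 1) =
        nLap G * (nLap G ^ m - nLap H ^ m) + (nLap G - nLap H) * nLap H ^ m := by
      rw [pow_succ', pow_succ']
      noncomm_ring
    have h1 : ∑ x, ∑ y, |(nLap G * (nLap G ^ m - nLap H ^ m)) x y| ≤
        (d + 1) * (m * (d + 1) ^ m * s) := by
      calc _ ≤ ∑ x, ∑ y, ∑ z, |nLap G x z| * |(nLap G ^ m - nLap H ^ m) z y| :=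
            sum_le_sum fun x _ => sum_le_sum fun y _ => hmul _ _ x y
        _ = ∑ z, (∑ x, |nLap G x z|) * ∑ y, |(nLap G ^ m - nLap H ^ m) z y| := by
          simp_rw [sum_mul_sum]
          rw [sum_congr rfl fun x _ => sum_comm, sum_comm]
        _ ≤ ∑ z, (d + 1) * ∑ y, |(nLap G ^ m - nLap H ^ m) z y| := by
          gcongr with z
          simp_rw [fun x => nLap_comm G x z]
          exact sum_abs_nLap_le hG z
        _ ≤ _ := by
          rw [← mul_sum]
          gcongr
    have h2 : ∑ x, ∑ y, |((nLap G - nLap H) * nLap H ^ m) x y| ≤ s * (d + 1) ^ m := by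
      calc _ ≤ ∑ x, ∑ y, ∑ z, |(nLap G - nLap H) x z| * |(nLap H ^ m) z y| :=
            sum_le_sum fun x _ => sum_le_sum fun y _ => hmul _ _ x y
        _ = ∑ x, ∑ z, |(nLap G - nLap H) x z| * ∑ y, |(nLap H ^ m) z y| := by
          simp_rw [mul_sum]
          exact sum_congr rfl fun x _ => sum_comm
        _ ≤ ∑ x, ∑ z, |(nLap G - nLap H) x z| * (d + 1) ^ m := by
          gcongr with x _ z
          exact sum_abs_nLap_pow_le hH m z
        _ = _ := by simp_rw [← sum_mul, hs]
    rw [hsplit]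
    calc _ ≤ ∑ x, ∑ y, (|(nLap G * (nLap G ^ m - nLap H ^ m)) x y| +
          |((nLap G - nLap H) * nLap H ^ m) x y|) :=
          sum_le_sum fun x _ => sum_le_sum fun y _ => abs_add_le _ _
      _ ≤ (d + 1) * (m * (d + 1) ^ m * s) + s * (d + 1) ^ m := by
        simp_rw [sum_add_distrib]
        exact add_le_add h1 h2
      _ ≤ _ := by
        have : s * (d + 1) ^ m ≤ s * (d + 1) ^ (m + 1) := by
          gcongr
          · simp
          · omega
        push_cast
        rw [pow_succ] at this ⊢
        linarith

/-- The factor by which a perturbation of the normalized Laplacian of graphs of maximal degree at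
most `d` is multiplied when passing to the polynomial `p` of it. -/
def perturbBound (p : Polynomial ℝ) (d : ℕ) : ℝ :=
  ∑ m ∈ range (p.natDegree + 1), |p.coeff m| * (m * (d + 1) ^ m)

theorem perturbBound_nonneg (p : Polynomial ℝ) (d : ℕ) : 0 ≤ perturbBound p d :=
  sum_nonneg fun _ _ => by positivity

theorem sum_abs_localEval_sub_le (hG : ∀ v, #(nbr G v) ≤ d) (hH : ∀ v, #(nbr H v) ≤ d)
    (p : Polynomial ℝ) : ∑ v, |localEval p G v - localEval p H v| ≤
      perturbBound p d * ∑ x, ∑ y, |(nLap G - nLap H) x y| := by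
  calc ∑ v, |localEval p G v - localEval p H v|
      ≤ ∑ v, ∑ m ∈ range (p.natDegree + 1), |p.coeff m| * |(nLap G ^ m - nLap H ^ m) v v| := by
        refine sum_le_sum fun v _ => ?_
        rw [localEval, localEval, ← sum_sub_distrib]
        refine (abs_sum_le_sum_abs _ _).trans_eq (sum_congr rfl fun m _ => ?_)
        rw [← mul_sub, abs_mul]
        rfl
    _ = ∑ m ∈ range (p.natDegree + 1), |p.coeff m| * ∑ v, |(nLap G ^ m - nLap H ^ m) v v| := by
        rw [sum_comm]
        simp_rw [mul_sum]
    _ ≤ ∑ m ∈ range (p.natDegree + 1), |p.coeff m| *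
          (m * (d + 1) ^ m * ∑ x, ∑ y, |(nLap G - nLap H) x y|) := by
        gcongr with m
        refine le_trans (sum_le_sum fun v _ => ?_) (sum_abs_nLap_pow_sub_le hG hH m)
        exact single_le_sum (f := fun y => |(nLap G ^ m - nLap H ^ m) v y|)
          (fun _ _ => abs_nonneg _) (mem_univ v)
    _ = _ := by
        rw [perturbBound, sum_mul]
        simp_rw [mul_assoc]

/-- An entry depends only on the neighbourhoods of its two indices, so it changes only in rows and
columns indexed by `T`. -/
theorem sum_abs_nLap_sub_le (hG : ∀ v, #(nbr G v) ≤ d) (hH : ∀ v, #(nbr H v) ≤ d) {T : Finset V}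
    (hT : ∀ x ∉ T, nbr G x = nbr H x) :
    ∑ x, ∑ y, |(nLap G - nLap H) x y| ≤ 4 * (d + 1) * #T := by
  have hrow : ∀ x, ∑ y, |(nLap G - nLap H) x y| ≤ 2 * (d + 1) := by
    intro x
    calc _ ≤ ∑ y, (|nLap G x y| + |nLap H x y|) := sum_le_sum fun y _ => abs_sub _ _
      _ ≤ _ := by
        rw [sum_add_distrib, two_mul]
        exact add_le_add (sum_abs_nLap_le hG x) (sum_abs_nLap_le hH x)
  have hsymm : ∀ x y, |(nLap G - nLap H) x y| = |(nLap G - nLap H) y x| := by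
    intro x y
    rw [Matrix.sub_apply, Matrix.sub_apply, nLap_comm G, nLap_comm H]
  have hsum : ∑ x ∈ T, ∑ y, |(nLap G - nLap H) x y| ≤ 2 * (d + 1) * #T := by
    calc _ ≤ ∑ x ∈ T, (2 * (d + 1) : ℝ) := sum_le_sum fun x _ => hrow x
      _ = _ := by rw [sum_const, nsmul_eq_mul, mul_comm]
  have hle : ∀ x y, |(nLap G - nLap H) x y| ≤
      (if x ∈ T then |(nLap G - nLap H) x y| else 0) +
        (if y ∈ T then |(nLap G - nLap H) x y| else 0) := by
    intro x y
    have h0 := abs_nonneg ((nLap G - nLap H) x y)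
    by_cases hx : x ∈ T
    · simp only [hx, if_true]
      split_ifs <;> linarith
    by_cases hy : y ∈ T
    · simp [hy, hx]
    · have hadj : G.Adj x y ↔ H.Adj x y := by
        rw [← mem_nbr, ← mem_nbr, hT x hx]
      simp [nLap, hx, hy, hT x hx, hT y hy, hadj]
  calc _ ≤ ∑ x, ∑ y, ((if x ∈ T then |(nLap G - nLap H) x y| else 0) +
        (if y ∈ T then |(nLap G - nLap H) x y| else 0)) :=
        sum_le_sum fun x _ => sum_le_sum fun y _ => hle x y
    _ = ∑ x ∈ T, ∑ y, |(nLap G - nLap H) x y| + ∑ y ∈ T, ∑ x, |(nLap G - nLap H) y x| := by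
        simp_rw [sum_add_distrib]
        congr 1
        · rw [← sum_filter_add_sum_filter_not univ (· ∈ T)]
          simp only [filter_mem_eq_inter, univ_inter]
          rw [sum_eq_zero (s := univ.filter fun x => x ∉ T), add_zero]
          · exact sum_congr rfl fun x hx => by simp [hx]
          · intro x hx
            simp [(mem_filter.1 hx).2]
        · rw [sum_comm]
          simp_rw [← hsymm]
          rw [← sum_filter_add_sum_filter_not univ (· ∈ T)]
          simp only [filter_mem_eq_inter, univ_inter]
          rw [sum_eq_zero (s := univ.filter fun x => x ∉ T), add_zero]
          · refine sum_congr rfl fun x hx => sum_congr rfl fun y _ => ?_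
            simp only [hx, if_true]
          · intro x hx
            simp [(mem_filter.1 hx).2]
    _ ≤ _ := by linarith

end Perturbation

/-! ### Polynomials of the Laplacian act componentwise -/

section Locality

variable {V W : Type} [Fintype V] [Fintype W]

/-- The map `φ` identifies `F` with a union of components of `G`. -/
def IsComponentMap {V W : Type} (F : SimpleGraph W) (G : SimpleGraph V) (φ : W → V) : Prop :=
  Function.Injective φ ∧ ∀ a y, G.Adj (φ a) y ↔ ∃ b, φ b = y ∧ F.Adj a b

variable {F : SimpleGraph W} {G : SimpleGraph V} {φ : W → V}

theorem IsComponentMap.adj_iff {V W : Type} {F : SimpleGraph W} {G : SimpleGraph V} {φ : W → V}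
    (h : IsComponentMap F G φ) {a b : W} :
    G.Adj (φ a) (φ b) ↔ F.Adj a b := by
  rw [h.2]
  constructor
  · rintro ⟨b', hb', hab⟩
    rwa [← h.1 hb']
  · exact fun hab => ⟨b, rfl, hab⟩

theorem IsComponentMap.card_nbr (h : IsComponentMap F G φ) (a : W) :
    #(nbr G (φ a)) = #(nbr F a) := by
  rw [← card_image_of_injective (nbr F a) h.1]
  congr 1
  ext y
  rw [mem_nbr, h.2, mem_image]
  simp [and_comm]

theorem IsComponentMap.nLap_apply (h : IsComponentMap F G φ) (a b : W) :
    nLap G (φ a) (φ b) = nLap F a b := by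
  simp [nLap, h.card_nbr, h.1.eq_iff, h.adj_iff]

theorem IsComponentMap.nLap_pow_apply (h : IsComponentMap F G φ) (m : ℕ) (a b : W) :
    (nLap G ^ m) (φ a) (φ b) = (nLap F ^ m) a b := by
  induction m generalizing a with
  | zero => simp [Matrix.one_apply, h.1.eq_iff]
  | succ m ih =>
    rw [pow_succ', pow_succ', Matrix.mul_apply, Matrix.mul_apply]
    have : ∑ y, nLap G (φ a) y * (nLap G ^ m) y (φ b) =
        ∑ y ∈ univ.image φ, nLap G (φ a) y * (nLap G ^ m) y (φ b) := by
      symm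
      refine sum_subset (subset_univ _) fun y _ hy => ?_
      have : nLap G (φ a) y = 0 := by
        by_contra hne
        apply hy
        rcases nLap_ne_zero hne with rfl | hadj
        · simp
        · obtain ⟨c, rfl, -⟩ := (h.2 a y).1 hadj
          simp
      rw [this, zero_mul]
    rw [this, sum_image fun _ _ _ _ => (h.1 ·)]
    exact sum_congr rfl fun c _ => by rw [h.nLap_apply, ih]

theorem IsComponentMap.localEval (h : IsComponentMap F G φ) (p : Polynomial ℝ) (a : W) :
    localEval p G (φ a) = localEval p F a := by
  simp only [SpectralTesting.localEval, h.nLap_pow_apply]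

end Locality

/-! ### Replacing the graph on a vertex set by copies of a small graph -/

section Glue

variable {V B : Type}

/-- Delete the edges between `U` and its complement. -/
def separate (G : SimpleGraph V) (U : Finset V) : SimpleGraph V where
  Adj x y := G.Adj x y ∧ (x ∈ U ↔ y ∈ U)
  symm := ⟨fun _ _ h => ⟨h.1.symm, h.2.symm⟩⟩
  loopless := ⟨fun _ h => G.irrefl h.1⟩

/-- Remove all edges meeting `U` and place a copy of the graph `Q` on `U`. -/
def glue (G : SimpleGraph V) (U : Finset V) (Q : SimpleGraph B) (ψ : U ≃ B) : SimpleGraph V where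
  Adj x y := (x ∉ U ∧ y ∉ U ∧ G.Adj x y) ∨
    ∃ (hx : x ∈ U) (hy : y ∈ U), Q.Adj (ψ ⟨x, hx⟩) (ψ ⟨y, hy⟩)
  symm := ⟨by
    rintro x y (h | ⟨hx, hy, h⟩)
    · exact .inl ⟨h.2.1, h.1, h.2.2.symm⟩
    · exact .inr ⟨hy, hx, h.symm⟩⟩
  loopless := ⟨by
    rintro x (h | ⟨hx, hy, h⟩)
    · exact G.irrefl h.2.2
    · exact Q.irrefl h⟩

variable (G : SimpleGraph V) (U : Finset V) (Q : SimpleGraph B) (ψ : U ≃ B)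

theorem isComponentMap_separate :
    IsComponentMap (G.induce {x | x ∉ U}) (separate G U) Subtype.val := by
  refine ⟨Subtype.val_injective, ?_⟩
  rintro ⟨a, ha⟩ y
  simp only [Set.mem_ofPred_eq] at ha
  simp [separate, ha, and_comm]

theorem isComponentMap_glue_compl :
    IsComponentMap (G.induce {x | x ∉ U}) (glue G U Q ψ) Subtype.val := by
  refine ⟨Subtype.val_injective, ?_⟩
  rintro ⟨a, ha⟩ y
  simp only [Set.mem_ofPred_eq] at ha
  simp [glue, ha]

theorem isComponentMap_glue :
    IsComponentMap Q (glue G U Q ψ) (fun b => (ψ.symm b : V)) := by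
  refine ⟨Subtype.val_injective.comp ψ.symm.injective, fun a y => ?_⟩
  constructor
  · rintro (h | ⟨hx, hy, h⟩)
    · exact absurd (ψ.symm a).2 h.1
    · exact ⟨ψ ⟨y, hy⟩, by simp, by simpa using h⟩
  · rintro ⟨b, rfl, h⟩
    exact .inr ⟨(ψ.symm a).2, (ψ.symm b).2, by simpa using h⟩

variable [Fintype V] [Fintype B]

/-- Outside `U`, both `glue` and `separate` consist of the same union of components, namely the
graph induced by `G`. -/
theorem polyTrace_glue [DecidableEq V] (p : Polynomial ℝ) : polyTrace p (glue G U Q ψ) =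
    ∑ x ∈ Uᶜ, localEval p (separate G U) x + polyTrace p Q := by
  rw [polyTrace, ← sum_compl_add_sum U]
  congr 1
  · refine sum_congr rfl fun x hx => ?_
    have hx : x ∉ U := by simpa using hx
    rw [(isComponentMap_glue_compl G U Q ψ).localEval p ⟨x, hx⟩,
      (isComponentMap_separate G U).localEval p ⟨x, hx⟩]
  · rw [← sum_coe_sort, polyTrace, ← ψ.symm.sum_comp]
    exact sum_congr rfl fun b _ => (isComponentMap_glue G U Q ψ).localEval p b

variable {G}

theorem card_nbr_separate_le (x : V) : #(nbr (separate G U) x) ≤ #(nbr G x) := by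
  refine card_le_card fun y hy => ?_
  rw [mem_nbr] at hy ⊢
  exact hy.1

theorem card_nbr_glue_le {d : ℕ} (hG : ∀ v, #(nbr G v) ≤ d) (hQ : ∀ v, #(nbr Q v) ≤ d) (x : V) :
    #(nbr (glue G U Q ψ) x) ≤ d := by
  by_cases hx : x ∈ U
  · have := (isComponentMap_glue G U Q ψ).card_nbr (ψ ⟨x, hx⟩)
    simp only [Equiv.symm_apply_apply] at this
    rw [this]
    exact hQ _
  · rw [(isComponentMap_glue_compl G U Q ψ).card_nbr ⟨x, hx⟩,
      ← (isComponentMap_separate G U).card_nbr ⟨x, hx⟩]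
    exact (card_nbr_separate_le U x).trans (hG x)

theorem card_crossing_le_mul {d : ℕ} (hG : ∀ v, #(nbr G v) ≤ d) : #(crossing G U) ≤ d * #U := by
  have hsub : crossing G U ⊆ U.biUnion fun x => (nbr G x).image fun y => (x, y) := by
    rintro ⟨x, y⟩ h
    rw [mem_crossing] at h
    simp [h]
  rw [mul_comm]
  exact (card_le_card hsub).trans
    (card_biUnion_le_card_mul _ _ _ fun x _ => card_image_le.trans (hG x))

theorem ncard_edges_meeting_le {d : ℕ} (hG : ∀ v, #(nbr G v) ≤ d) :
    {e ∈ G.edgeSet | ∃ x ∈ U, x ∈ e}.ncard ≤ d * #U := by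
  have hsub : {e ∈ G.edgeSet | ∃ x ∈ U, x ∈ e} ⊆
      ((U.biUnion fun x => (nbr G x).image fun y => s(x, y) : Finset (Sym2 V)) : Set (Sym2 V)) := by
    rintro e ⟨he, x, hx, hxe⟩
    obtain ⟨y, rfl⟩ := Sym2.mem_iff_exists.1 hxe
    rw [mem_coe, mem_biUnion]
    exact ⟨x, hx, mem_image.2 ⟨y, mem_nbr.2 he, rfl⟩⟩
  calc _ ≤ _ := Set.ncard_le_ncard hsub (Set.toFinite _)
    _ ≤ #U * d := by
      rw [Set.ncard_coe_finset]
      exact card_biUnion_le_card_mul _ _ _ fun x _ => card_image_le.trans (hG x)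
    _ = _ := mul_comm _ _

theorem ncard_symmDiff_glue_le {d : ℕ} (hG : ∀ v, #(nbr G v) ≤ d) (hQ : ∀ v, #(nbr Q v) ≤ d)
    (G₀ : SimpleGraph V) : (symmDiff G₀.edgeSet (glue G U Q ψ).edgeSet).ncard ≤
      (symmDiff G₀.edgeSet G.edgeSet).ncard + 2 * (d * #U) := by
  have hsub : symmDiff G₀.edgeSet (glue G U Q ψ).edgeSet ⊆ symmDiff G₀.edgeSet G.edgeSet ∪
      ({e ∈ G.edgeSet | ∃ x ∈ U, x ∈ e} ∪ {e ∈ (glue G U Q ψ).edgeSet | ∃ x ∈ U, x ∈ e}) := by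
    intro e he
    induction e with
    | _ x y =>
    have key : x ∉ U → y ∉ U → ((glue G U Q ψ).Adj x y ↔ G.Adj x y) := by
      intro hx hy
      simp [glue, hx, hy]
    simp only [Set.mem_symmDiff, SimpleGraph.mem_edgeSet, Set.mem_union, Set.mem_ofPred_eq,
      Sym2.mem_iff] at he ⊢
    by_cases hx : x ∈ U
    · have : ∃ z ∈ U, z = x ∨ z = y := ⟨x, hx, .inl rfl⟩
      simp only [this, and_true]
      clear this
      tauto
    by_cases hy : y ∈ U
    · have : ∃ z ∈ U, z = x ∨ z = y := ⟨y, hy, .inr rfl⟩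
      simp only [this, and_true]
      clear this
      tauto
    · rw [key hx hy] at he
      tauto
  calc _ ≤ _ := Set.ncard_le_ncard hsub (Set.toFinite _)
    _ ≤ _ := Set.ncard_union_le _ _
    _ ≤ _ := by
      gcongr
      refine (Set.ncard_union_le _ _).trans ?_
      rw [two_mul]
      exact add_le_add (ncard_edges_meeting_le U hG)
        (ncard_edges_meeting_le U (card_nbr_glue_le U Q ψ hG hQ))

/-- Only endpoints of crossing edges change their neighbourhoods. -/
theorem sum_abs_nLap_sub_separate_le {d : ℕ} (hG : ∀ v, #(nbr G v) ≤ d) :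
    ∑ x, ∑ y, |(nLap G - nLap (separate G U)) x y| ≤ 4 * (d + 1) * (2 * #(crossing G U)) := by
  set T := (crossing G U).image Prod.fst ∪ (crossing G U).image Prod.snd with hT
  have h := sum_abs_nLap_sub_le (T := T) hG (fun v => (card_nbr_separate_le U v).trans (hG v)) ?_
  · refine h.trans ?_
    gcongr
    have : #T ≤ 2 * #(crossing G U) := by
      rw [two_mul]
      exact (card_union_le _ _).trans (add_le_add card_image_le card_image_le)
    exact_mod_cast this
  · intro x hx
    ext y
    simp only [hT, mem_union, mem_image, mem_crossing, not_or, not_exists, not_and, Prod.forall]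
      at hx
    simp only [mem_nbr, separate]
    have h1 := hx.1 x y
    have h2 := hx.2 y x
    have h3 := G.adj_comm x y
    simp only [not_true_eq_false, imp_false, not_and] at h1 h2
    tauto

/-- The disjoint union of `q` copies of `F` and `r` isolated vertices. -/
def copies {f : ℕ} (q r : ℕ) (F : SimpleGraph (Fin f)) : SimpleGraph ((Fin q × Fin f) ⊕ Fin r) where
  Adj x y := ∃ i a b, x = .inl (i, a) ∧ y = .inl (i, b) ∧ F.Adj a b
  symm := ⟨by
    rintro x y ⟨i, a, b, hx, hy, h⟩
    exact ⟨i, b, a, hy, hx, h.symm⟩⟩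
  loopless := ⟨by
    rintro x ⟨i, a, b, rfl, hy, h⟩
    simp only [Sum.inl.injEq, Prod.mk.injEq, true_and] at hy
    exact h.ne hy⟩

variable {f : ℕ} (q r : ℕ) (F : SimpleGraph (Fin f))

theorem isComponentMap_copies (i : Fin q) :
    IsComponentMap F (copies q r F) (fun a => .inl (i, a)) := by
  refine ⟨fun a b h => by simpa using h, fun a y => ?_⟩
  constructor
  · rintro ⟨i', a', b, h1, rfl, h⟩
    simp only [Sum.inl.injEq, Prod.mk.injEq] at h1
    obtain ⟨rfl, rfl⟩ := h1
    exact ⟨b, rfl, h⟩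
  · rintro ⟨b, rfl, h⟩
    exact ⟨i, a, b, rfl, rfl, h⟩

variable {F} {d : ℕ}

theorem card_nbr_copies_le (hF : ∀ v, #(nbr F v) ≤ d) (x : (Fin q × Fin f) ⊕ Fin r) : #(nbr (copies q r F) x) ≤ d := by
  rcases x with ⟨i, a⟩ | j
  · rw [(isComponentMap_copies q r F i).card_nbr a]
    exact hF a
  · have : nbr (copies q r F) (.inr j) = ∅ := by
      ext y
      simp [copies]
    simp [this]

theorem abs_polyTrace_copies_sub_le (hF : ∀ v, #(nbr F v) ≤ d) (p : Polynomial ℝ) :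
    |polyTrace p (copies q r F) - q * polyTrace p F| ≤ r * evalBound p d := by
  have h1 : ∑ x : Fin q × Fin f, localEval p (copies q r F) (.inl x) = q * polyTrace p F := by
    rw [Fintype.sum_prod_type]
    simp_rw [fun i a => (isComponentMap_copies q r F i).localEval p a]
    simp [polyTrace]
  rw [polyTrace, Fintype.sum_sum_type, h1, add_sub_cancel_left]
  calc _ ≤ ∑ j : Fin r, |localEval p (copies q r F) (.inr j)| := abs_sum_le_sum_abs _ _
    _ ≤ ∑ j : Fin r, evalBound p d :=
      sum_le_sum fun j _ => abs_localEval_le p (card_nbr_copies_le q r hF) _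
    _ = _ := by simp

end Glue

/-! ### Mixing the spectral distribution with that of a bounded graph -/

section Transform

theorem abs_polyTrace_div_le {d f : ℕ} (hf : 0 < f) {F : SimpleGraph (Fin f)}
    (hF : ∀ v, #(nbr F v) ≤ d) (p : Polynomial ℝ) : |polyTrace p F / f| ≤ evalBound p d := by
  have hf' : (0 : ℝ) < f := by exact_mod_cast hf
  rw [abs_div, Nat.abs_cast, div_le_iff₀ hf']
  calc _ ≤ ∑ v, |localEval p F v| := abs_sum_le_sum_abs _ _
    _ ≤ ∑ v : Fin f, evalBound p d := sum_le_sum fun v _ => abs_localEval_le p hF v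
    _ = _ := by simp [mul_comm]

/-- A graph of large girth can be edited in a proportion `ρ` of its vertices so that its
normalized Laplacian has approximately the spectral distribution of the disjoint union of a
proportion `1 - ρ` of the given graph and a proportion `ρ` of a graph of bounded size. -/
theorem exists_edited (d M : ℕ) {L : ℕ} (hL : 1 ≤ L) {ρ : ℝ} (hρ : 0 ≤ ρ) (hρ1 : ρ ≤ 1) :
    ∃ (κ : ℝ) (C : Polynomial ℝ → ℝ), 0 ≤ κ ∧ ∀ (n : ℕ) (G₀ : SimpleGraph (Fin n)),
      (∀ v, #(nbr G₀ v) ≤ d) → (L : ℕ∞) < G₀.egirth → ∀ (f : ℕ) (F : SimpleGraph (Fin f)),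
      0 < f → f ≤ M → (∀ v, #(nbr F v) ≤ d) → ∃ G : SimpleGraph (Fin n),
        (∀ v, #(nbr G v) ≤ d) ∧
        ((symmDiff G₀.edgeSet G.edgeSet).ncard : ℝ) ≤ 4 * (d * (ρ * n + κ)) ∧
        ∀ p : Polynomial ℝ, p.natDegree ≤ L →
          |polyTrace p G - ((1 - ρ) * polyTrace p G₀ + ρ * n * (polyTrace p F / f))| ≤ C p := by
  obtain ⟨K, hK⟩ := exists_finset_color d L
  obtain ⟨K', hK'⟩ := exists_finset_color d (L + 1)
  set κ : ℝ := (#K' : ℝ) with hκ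
  set R : ℝ := #K ^ 2 * (((d + 1) ^ (L + 3)) ^ 2 + 2 * (κ * d)) with hR
  -- The errors, all independent of `n`, come from: the rounding of `U`, the deletion of at most `R`
  -- crossing edges, the at most `M` isolated vertices left over on `U`, and the deviation of the
  -- number of copies from `ρ * n / f`.
  refine ⟨κ, fun p => κ * evalBound p d + perturbBound p d * (4 * (d + 1) * (2 * R)) +
    (M * evalBound p d + (κ + M) * evalBound p d), Nat.cast_nonneg _, ?_⟩
  intro n G₀ hG₀ hg f F hf hfM hF
  obtain ⟨U, hU⟩ := exists_proportional (color G₀ (L + 1)) K' (hK' n G₀ hG₀) hρ hρ1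
  obtain ⟨G₁, hcol, hg₁, hsymm, hred⟩ := exists_reduced G₀ U L hL hg
  have hG₁ : ∀ v, #(nbr G₁ v) ≤ d := fun v => by
    rw [card_nbr_eq_of_color_eq (hcol (L + 1) le_rfl v)]
    exact hG₀ v
  have hU₁ : Proportional (color G₁ (L + 1)) ρ κ U := by
    rw [funext (hcol (L + 1) le_rfl)]
    exact hU
  have hcross : (#(crossing G₁ U) : ℝ) ≤ R :=
    card_crossing_le hG₁ (Nat.cast_nonneg _) hU₁ (hK n G₁ hG₁) hred
  have hUcard : |(#U : ℝ) - ρ * n| ≤ κ := by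
    have := hU (fun _ => 1) 1 zero_le_one (fun _ _ _ => rfl) (fun _ => by simp)
    simpa using this
  have hψ : Fintype.card U = Fintype.card ((Fin (#U / f) × Fin f) ⊕ Fin (#U % f)) := by
    simp [Nat.div_add_mod']
  set ψ := Fintype.equivOfCardEq hψ
  set Q := copies (#U / f) (#U % f) F
  have hQ : ∀ v, #(nbr Q v) ≤ d := card_nbr_copies_le _ _ hF
  refine ⟨glue G₁ U Q ψ, card_nbr_glue_le U Q ψ hG₁ hQ, ?_, fun p hp => ?_⟩
  · have h1 := ncard_symmDiff_glue_le U Q ψ hG₁ hQ G₀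
    have h2 := card_crossing_le_mul U hG₀
    -- The swaps cost at most twice the number of edges crossing originally, and the replacement on
    -- `U` costs another `2 * (d * #U)`.
    have h3 : (symmDiff G₀.edgeSet (glue G₁ U Q ψ).edgeSet).ncard ≤ 4 * (d * #U) := by omega
    calc _ ≤ ((4 * (d * #U) : ℕ) : ℝ) := by exact_mod_cast h3
      _ ≤ _ := by
        push_cast
        gcongr
        linarith [(abs_le.1 hUcard).2]
  · have hE := evalBound_nonneg p d
    have h1 : |∑ x ∈ Uᶜ, localEval p G₀ x - (1 - ρ) * polyTrace p G₀| ≤ κ * evalBound p d := by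
      have := hU (localEval p G₀) _ hE
        (fun x y hxy => localEval_eq_of_color_eq hp hg hg hxy) (abs_localEval_le p hG₀)
      have h2 : polyTrace p G₀ = _ := (sum_compl_add_sum U (localEval p G₀)).symm
      change |_ - ρ * polyTrace p G₀| ≤ _ at this
      rw [abs_le] at this ⊢
      constructor <;> linarith
    have h2 : ∑ x ∈ Uᶜ, localEval p G₁ x = ∑ x ∈ Uᶜ, localEval p G₀ x :=
      sum_congr rfl fun x _ => localEval_eq_of_color_eq hp hg₁ hg (hcol _ le_rfl x)
    have h3 : |∑ x ∈ Uᶜ, localEval p (separate G₁ U) x - ∑ x ∈ Uᶜ, localEval p G₁ x| ≤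
        perturbBound p d * (4 * (d + 1) * (2 * R)) := by
      rw [abs_sub_comm, ← sum_sub_distrib]
      calc _ ≤ ∑ x ∈ Uᶜ, |localEval p G₁ x - localEval p (separate G₁ U) x| :=
            abs_sum_le_sum_abs _ _
        _ ≤ ∑ x, |localEval p G₁ x - localEval p (separate G₁ U) x| :=
            sum_le_sum_of_subset_of_nonneg (subset_univ _) fun _ _ _ => abs_nonneg _
        _ ≤ _ := sum_abs_localEval_sub_le hG₁
            (fun v => (card_nbr_separate_le U v).trans (hG₁ v)) p
        _ ≤ _ := by
          have := perturbBound_nonneg p d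
          gcongr
          refine (sum_abs_nLap_sub_separate_le U hG₁).trans ?_
          gcongr
    set t := polyTrace p F / f with ht
    have hf' : (0 : ℝ) < f := by exact_mod_cast hf
    have htE : |t| ≤ evalBound p d := abs_polyTrace_div_le hf hF p
    have hr : ((#U % f : ℕ) : ℝ) ≤ M := by
      exact_mod_cast (Nat.mod_lt _ hf).le.trans hfM
    have h4 : |polyTrace p Q - (#U / f : ℕ) * polyTrace p F| ≤ M * evalBound p d :=
      (abs_polyTrace_copies_sub_le _ _ hF p).trans (by gcongr)
    have h5 : |(#U / f : ℕ) * polyTrace p F - ρ * n * t| ≤ (κ + M) * evalBound p d := by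
      have hmod : ((#U / f : ℕ) : ℝ) * f = #U - (#U % f : ℕ) := by
        have : ((#U / f * f + #U % f : ℕ) : ℝ) = #U := by rw [Nat.div_add_mod']
        push_cast at this ⊢
        linarith
      have : (#U / f : ℕ) * polyTrace p F - ρ * n * t = (#U - (#U % f : ℕ) - ρ * n) * t := by
        rw [sub_mul, ← hmod, ht]
        field_simp
      rw [this, abs_mul]
      gcongr
      have hr0 : (0 : ℝ) ≤ (#U % f : ℕ) := Nat.cast_nonneg _
      have := abs_le.1 hUcard
      have hM0 : (0 : ℝ) ≤ M := Nat.cast_nonneg _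
      rw [abs_le]
      constructor <;> linarith
    rw [polyTrace_glue]
    rw [h2] at h3
    rw [abs_le] at h1 h3 h4 h5 ⊢
    dsimp only
    constructor <;> linarith

/-- The spectral distributions of bounded degree graphs are approximated by those of graphs of
bounded size. -/
theorem exists_small_graph (d N : ℕ) (p : ℕ → Polynomial ℝ) {η : ℝ} (hη : 0 < η) :
    ∃ M : ℕ, ∀ (n : ℕ) (H : SimpleGraph (Fin n)), 0 < n → (∀ v, #(nbr H v) ≤ d) →
      ∃ (f : ℕ) (F : SimpleGraph (Fin f)), 0 < f ∧ f ≤ M ∧ (∀ v, #(nbr F v) ≤ d) ∧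
        ∀ l < N, |polyTrace (p l) F / f - polyTrace (p l) H / n| ≤ η := by
  -- Round the normalized traces to a grid of mesh `η`. Only the finitely many grid points in `Y`
  -- occur, and one graph is chosen for each attained one; `M` is the largest size chosen.
  let key (n : ℕ) (H : SimpleGraph (Fin n)) (l : Fin N) : ℤ := ⌊polyTrace (p l) H / n / η⌋
  let attained (y : Fin N → ℤ) (m : ℕ) : Prop :=
    ∃ F : SimpleGraph (Fin m), 0 < m ∧ (∀ v, #(nbr F v) ≤ d) ∧ key m F = y
  let size (y : Fin N → ℤ) : ℕ := if h : ∃ m, attained y m then h.choose else 0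
  let b (l : Fin N) : ℤ := ⌈evalBound (p l) d / η⌉ + 1
  let Y : Finset (Fin N → ℤ) := Fintype.piFinset fun l => Icc (-b l) (b l)
  refine ⟨Y.sup size, fun n H hn hH => ?_⟩
  have hatt : ∃ m, attained (key n H) m := ⟨n, H, hn, hH, rfl⟩
  have hsize : size (key n H) = hatt.choose := dif_pos hatt
  obtain ⟨F, hF0, hF, hkey⟩ := hatt.choose_spec
  refine ⟨hatt.choose, F, hF0, ?_, hF, fun l hl => ?_⟩
  · rw [← hsize]
    apply le_sup (f := size)
    rw [Fintype.mem_piFinset]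
    intro l
    have h1 := abs_le.1 (abs_polyTrace_div_le hn hH (p l))
    have h2 := Int.le_ceil (evalBound (p l) d / η)
    have h3 : polyTrace (p l) H / n / η ≤ evalBound (p l) d / η := by
      gcongr
      exact h1.2
    have h4 : -(evalBound (p l) d / η) ≤ polyTrace (p l) H / n / η := by
      rw [← neg_div]
      gcongr
      exact h1.1
    rw [mem_Icc]
    constructor
    · apply Int.le_floor.2
      simp only [b]
      push_cast
      linarith
    · have : (key n H l : ℝ) ≤ b l := by
        refine (Int.floor_le _).trans ?_
        simp only [b]
        push_cast
        linarith
      exact_mod_cast this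
  · have := Int.abs_sub_lt_one_of_floor_eq_floor (congrFun hkey ⟨l, hl⟩)
    rw [← sub_div, abs_div, abs_of_pos hη, div_lt_one hη] at this
    exact this.le

end Transform

/-! ### Editing a nearly close graph, and spectra from colour statistics -/

section Closeness

/-- A graph of large girth whose spectrum has distance slightly more than `δ n` from a realized
spectrum can be edited so that the distance becomes at most `δ n`. -/
theorem exists_close {d : ℕ} {δ ε : ℝ} (hδ : 0 < δ) (hε : 0 < ε) :
    ∃ (γ : ℝ) (L n₀ : ℕ), 0 < γ ∧ 0 < n₀ ∧ ∀ (n : ℕ) (G₀ H : SimpleGraph (Fin n)), n₀ ≤ n →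
      (∀ v, #(nbr G₀ v) ≤ d) → (L : ℕ∞) < G₀.egirth → (∀ v, #(nbr H v) ≤ d) →
      ∑ i, |graphSpectrum G₀ i - graphSpectrum H i| ≤ (δ + γ) * n →
      ∃ G : SimpleGraph (Fin n), (∀ v, #(nbr G v) ≤ d) ∧
        ((symmDiff G₀.edgeSet G.edgeSet).ncard : ℝ) ≤ ε * d * n ∧
        ∑ i, |graphSpectrum G i - graphSpectrum H i| ≤ δ * n := by
  -- Editing costs `4 * (d * (ρ * n + κ))`, which is at most `8 * ρ * d * n` once `κ ≤ ρ * n`.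
  set ρ : ℝ := min ε 1 / 8 with hρdef
  have hρ : 0 < ρ := by positivity
  have hρε : 8 * ρ ≤ ε := by
    have := min_le_left ε 1
    linarith
  have hρ1 : ρ ≤ 1 := by
    have := min_le_right ε 1
    linarith
  set γ := ρ * δ / 8 with hγdef
  have hγ : 0 < γ := by positivity
  obtain ⟨N, p, htest⟩ := exists_trace_tests d hγ
  set L := (range N).sup (fun l => (p l).natDegree) + 1 with hL
  have hpL : ∀ l < N, (p l).natDegree ≤ L := fun l hl =>
    (le_sup (f := fun l => (p l).natDegree) (mem_range.2 hl)).trans (Nat.le_succ _)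
  set η := δ / (8 * (N + 1)) with hηdef
  have hη : 0 < η := by positivity
  obtain ⟨M, hM⟩ := exists_small_graph d N p hη
  obtain ⟨κ, C, hκ, hedit⟩ := exists_edited d M (by omega : 1 ≤ L) hρ.le hρ1
  obtain ⟨n₁, hn₁⟩ := exists_nat_ge (κ / ρ)
  obtain ⟨n₂, hn₂⟩ := exists_nat_ge ((∑ l ∈ range N, C (p l)) / (ρ * δ / 8))
  refine ⟨γ, L, max (max n₁ n₂) 1, hγ, by omega, fun n G₀ H hn hG₀ hg hH hdist => ?_⟩
  have hn0 : 0 < n := by omega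
  have hn0' : (0 : ℝ) < n := by exact_mod_cast hn0
  have hκn : κ ≤ ρ * n := by
    have h1 : (n₁ : ℝ) ≤ n := by exact_mod_cast (by omega : n₁ ≤ n)
    have := hn₁.trans h1
    rw [div_le_iff₀ hρ] at this
    linarith
  have hCn : ∑ l ∈ range N, C (p l) ≤ ρ * δ / 8 * n := by
    have h1 : (n₂ : ℝ) ≤ n := by exact_mod_cast (by omega : n₂ ≤ n)
    have := hn₂.trans h1
    rw [div_le_iff₀ (by positivity)] at this
    linarith
  obtain ⟨f, F, hf, hfM, hF, hFH⟩ := hM n H hn0 hH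
  obtain ⟨G, hG, hsymm, htr⟩ := hedit n G₀ hG₀ hg f F hf hfM hF
  refine ⟨G, hG, hsymm.trans ?_, ?_⟩
  · calc 4 * (d * (ρ * n + κ)) ≤ 4 * (d * (ρ * n + ρ * n)) := by gcongr
      _ = 8 * ρ * d * n := by ring
      _ ≤ _ := by gcongr
  · have h1 : ∀ l ∈ range N, |polyTrace (p l) G - polyTrace (p l) H| ≤
        (1 - ρ) * |polyTrace (p l) G₀ - polyTrace (p l) H| + ρ * n * η + C (p l) := by
      intro l hl
      have hl := mem_range.1 hl
      have e1 := abs_le.1 (htr (p l) (hpL l hl))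
      have e2 := hFH l hl
      have e3 : |ρ * n * (polyTrace (p l) F / f) - ρ * polyTrace (p l) H| ≤ ρ * n * η := by
        have : ρ * n * (polyTrace (p l) F / f) - ρ * polyTrace (p l) H =
            ρ * n * (polyTrace (p l) F / f - polyTrace (p l) H / n) := by
          field_simp
        rw [this, abs_mul, abs_of_pos (by positivity : 0 < ρ * n)]
        gcongr
      have e4 : |(1 - ρ) * (polyTrace (p l) G₀ - polyTrace (p l) H)| =
          (1 - ρ) * |polyTrace (p l) G₀ - polyTrace (p l) H| := by
        rw [abs_mul, abs_of_nonneg (by linarith)]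
      rw [← e4]
      have e5 := abs_le.1 e3
      have e6 := le_abs_self ((1 - ρ) * (polyTrace (p l) G₀ - polyTrace (p l) H))
      have e7 := neg_abs_le ((1 - ρ) * (polyTrace (p l) G₀ - polyTrace (p l) H))
      rw [abs_le]
      constructor <;> linarith
    have h2 := sum_le_sum h1
    rw [sum_add_distrib, sum_add_distrib, ← mul_sum, sum_const, card_range, nsmul_eq_mul] at h2
    have h3 := (abs_le.1 (htest n G₀ H hG₀ hH)).1
    have h4 := (abs_le.1 (htest n G H hG hH)).2
    have h5 : ∑ l ∈ range N, |polyTrace (p l) G₀ - polyTrace (p l) H| ≤ (δ + 2 * γ) * n := by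
      linarith
    have h6 : (1 - ρ) * ∑ l ∈ range N, |polyTrace (p l) G₀ - polyTrace (p l) H| ≤
        (1 - ρ) * ((δ + 2 * γ) * n) := mul_le_mul_of_nonneg_left h5 (by linarith)
    have h7 : N * (ρ * n * η) ≤ ρ * δ / 8 * n := by
      have : N * η ≤ δ / 8 := by
        rw [hηdef, mul_div_assoc', div_le_div_iff₀ (by positivity) (by norm_num)]
        nlinarith
      calc N * (ρ * n * η) = ρ * n * (N * η) := by ring
        _ ≤ ρ * n * (δ / 8) := by gcongr
        _ = _ := by ring
    have h8 : 0 ≤ ρ * γ * n := by positivity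
    have h9 : γ * n = ρ * δ * n / 8 := by rw [hγdef]; ring
    have h10 : 0 ≤ ρ * δ * n := by positivity
    -- The factor `1 - ρ` gains `ρ * δ * n`. Of this, at most three eighths go to the three errors
    -- `γ * n`, one eighth to `η`, and one eighth to the constants `C (p l)`.
    nlinarith

/-- The number of vertices of a given colour. -/
def colorCount {n : ℕ} (G : SimpleGraph (Fin n)) (k a : ℕ) : ℕ :=
  #(univ.filter fun v => color G k v = a)

theorem sum_comp_color {n : ℕ} (G : SimpleGraph (Fin n)) (k : ℕ) {K : Finset ℕ}
    (hK : ∀ v, color G k v ∈ K) (φ : ℕ → ℝ) :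
    ∑ v, φ (color G k v) = ∑ a ∈ K, colorCount G k a * φ a := by
  rw [← sum_fiberwise_of_maps_to (fun v _ => hK v)]
  refine sum_congr rfl fun a _ => ?_
  rw [sum_congr rfl fun v hv => by rw [(mem_filter.1 hv).2], sum_const, nsmul_eq_mul]
  rfl

theorem abs_polyTrace_sub_le_of_colorCount {d L n : ℕ} {G H : SimpleGraph (Fin n)}
    (hG : ∀ v, #(nbr G v) ≤ d) (hH : ∀ v, #(nbr H v) ≤ d) (hgG : (L : ℕ∞) < G.egirth)
    (hgH : (L : ℕ∞) < H.egirth) {K : Finset ℕ} (hKG : ∀ v, color G (L + 1) v ∈ K)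
    (hKH : ∀ v, color H (L + 1) v ∈ K) {p : Polynomial ℝ} (hp : p.natDegree ≤ L) :
    |polyTrace p G - polyTrace p H| ≤ evalBound p d *
      ∑ a ∈ K, |(colorCount G (L + 1) a : ℝ) - colorCount H (L + 1) a| := by
  -- One function of the colour gives the local values in both graphs, so the traces can be compared
  -- through colour counts alone; the value at colours occurring in neither graph is irrelevant.
  let φ (a : ℕ) : ℝ := if h : ∃ v, color G (L + 1) v = a then localEval p G h.choose else
    if h : ∃ v, color H (L + 1) v = a then localEval p H h.choose else 0
  have hφG : ∀ v, localEval p G v = φ (color G (L + 1) v) := by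
    intro v
    have h : ∃ w, color G (L + 1) w = color G (L + 1) v := ⟨v, rfl⟩
    simp only [φ, dif_pos h]
    exact localEval_eq_of_color_eq hp hgG hgG h.choose_spec.symm
  have hφH : ∀ v, localEval p H v = φ (color H (L + 1) v) := by
    intro v
    have h : ∃ w, color H (L + 1) w = color H (L + 1) v := ⟨v, rfl⟩
    by_cases h' : ∃ w, color G (L + 1) w = color H (L + 1) v
    · simp only [φ, dif_pos h']
      exact localEval_eq_of_color_eq hp hgH hgG h'.choose_spec.symm
    · simp only [φ, dif_neg h', dif_pos h]
      exact localEval_eq_of_color_eq hp hgH hgH h.choose_spec.symm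
  have hφ : ∀ a, |φ a| ≤ evalBound p d := by
    intro a
    simp only [φ]
    split_ifs
    · exact abs_localEval_le p hG _
    · exact abs_localEval_le p hH _
    · simpa using evalBound_nonneg p d
  rw [polyTrace, polyTrace, sum_congr rfl fun v _ => hφG v, sum_congr rfl fun v _ => hφH v,
    sum_comp_color G _ hKG, sum_comp_color H _ hKH, ← sum_sub_distrib, mul_sum]
  refine (abs_sum_le_sum_abs _ _).trans (sum_le_sum fun a _ => ?_)
  rw [← sub_mul, abs_mul, mul_comm]
  gcongr
  exact hφ a

/-- Graphs of large girth with similar colour statistics have similar spectra. -/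
theorem exists_spectrum_close_of_colorCount (d L₀ : ℕ) {γ : ℝ} (hγ : 0 < γ) :
    ∃ (L : ℕ) (η : ℝ), L₀ ≤ L ∧ 0 < η ∧ ∀ (n : ℕ) (G H : SimpleGraph (Fin n)) (K : Finset ℕ),
      (∀ v, #(nbr G v) ≤ d) → (∀ v, #(nbr H v) ≤ d) → (L : ℕ∞) < G.egirth → (L : ℕ∞) < H.egirth →
      (∀ v, color G (L + 1) v ∈ K) → (∀ v, color H (L + 1) v ∈ K) →
      ∑ a ∈ K, |(colorCount G (L + 1) a : ℝ) - colorCount H (L + 1) a| ≤ η * n →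
      ∑ i, |graphSpectrum G i - graphSpectrum H i| ≤ γ * n := by
  obtain ⟨N, p, htest⟩ := exists_trace_tests d (half_pos hγ)
  set E := ∑ l ∈ range N, evalBound (p l) d with hE
  have hE0 : 0 ≤ E := sum_nonneg fun _ _ => evalBound_nonneg _ _
  -- Half of `γ` is spent on the trace tests, half on the colour counts; the `+ 1` covers `E = 0`.
  refine ⟨max L₀ ((range N).sup fun l => (p l).natDegree), γ / 2 / (E + 1), le_max_left _ _,
    by positivity, fun n G H K hG hH hgG hgH hKG hKH hc => ?_⟩
  have h1 := (abs_le.1 (htest n G H hG hH)).2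
  have h2 : ∑ l ∈ range N, |polyTrace (p l) G - polyTrace (p l) H| ≤
      E * (γ / 2 / (E + 1) * n) := by
    rw [hE, sum_mul]
    refine sum_le_sum fun l hl => ?_
    refine (abs_polyTrace_sub_le_of_colorCount hG hH hgG hgH hKG hKH
      ((le_sup (f := fun l => (p l).natDegree) hl).trans (le_max_right _ _))).trans ?_
    have := evalBound_nonneg (p l) d
    gcongr
  have h3 : E * (γ / 2 / (E + 1) * n) ≤ γ / 2 * n := by
    have : E * (γ / 2 / (E + 1)) ≤ γ / 2 := by
      rw [mul_div_assoc', div_le_iff₀ (by positivity)]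
      nlinarith
    calc _ = E * (γ / 2 / (E + 1)) * n := by ring
      _ ≤ _ := by gcongr
  linarith

end Closeness

/-! ### Computing colours by adjacency-list queries -/

section Queries

variable {n d : ℕ}

/-- The colours computed from an oracle. -/
def oracleColor (O : Oracle n d) : ℕ → Fin n → ℕ
  | 0, _ => 0
  | j + 1, v => Encodable.encode
      ((((List.finRange d).filterMap (O v)).map (oracleColor O j) : List ℕ) : Multiset ℕ)

/-- Query the neighbours of `v` in the places `l`, apply the procedure `ex` to each of them, and
continue with the multiset of results. -/
def queryNbrs (ex : Fin n → (ℕ → QueryTree n d) → QueryTree n d) (v : Fin n) :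
    List (Fin d) → (Multiset ℕ → QueryTree n d) → QueryTree n d
  | [], cont => cont 0
  | i :: l, cont => .query v i fun w => match w with
    | none => queryNbrs ex v l cont
    | some w => ex w fun c => queryNbrs ex v l fun m => cont (c ::ₘ m)

/-- Compute the colour of `v` of level `j` and continue with the result. -/
def explore : ℕ → Fin n → (ℕ → QueryTree n d) → QueryTree n d
  | 0, _, cont => cont 0
  | j + 1, v, cont => queryNbrs (explore j) v (List.finRange d) fun m => cont (Encodable.encode m)

theorem run_queryNbrs {O : Oracle n d} {ex : Fin n → (ℕ → QueryTree n d) → QueryTree n d}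
    {c : Fin n → ℕ} (hex : ∀ v cont, (ex v cont).run O = (cont (c v)).run O) (v : Fin n)
    (l : List (Fin d)) (cont : Multiset ℕ → QueryTree n d) :
    (queryNbrs ex v l cont).run O = (cont (((l.filterMap (O v)).map c : List ℕ))).run O := by
  induction l generalizing cont with
  | nil => rfl
  | cons i l ih =>
    rw [queryNbrs, QueryTree.run]
    rcases h : O v i with _ | w
    · simp only [ih, List.filterMap_cons_none h]
    · simp only [hex, ih, List.filterMap_cons_some h, List.map_cons, Multiset.cons_coe]

theorem run_explore (O : Oracle n d) (j : ℕ) (v : Fin n) (cont : ℕ → QueryTree n d) :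
    (explore j v cont).run O = (cont (oracleColor O j v)).run O := by
  induction j generalizing v cont with
  | zero => rfl
  | succ j ih => rw [explore, run_queryNbrs ih, oracleColor]

theorem numQueries_queryNbrs_le {O : Oracle n d}
    {ex : Fin n → (ℕ → QueryTree n d) → QueryTree n d} {s : ℕ}
    (hex : ∀ v cont b, (∀ c, (cont c).numQueries O ≤ b) → (ex v cont).numQueries O ≤ s + b)
    (v : Fin n) (l : List (Fin d)) (cont : Multiset ℕ → QueryTree n d) (b : ℕ)
    (hb : ∀ m, (cont m).numQueries O ≤ b) :
    (queryNbrs ex v l cont).numQueries O ≤ l.length * (s + 1) + b := by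
  induction l generalizing cont with
  | nil => simpa [queryNbrs] using hb 0
  | cons i l ih =>
    rw [queryNbrs, QueryTree.numQueries, List.length_cons, Nat.add_mul]
    rcases O v i with _ | w
    · have := ih cont hb
      dsimp only
      omega
    · have := hex w (fun c => queryNbrs ex v l fun m => cont (c ::ₘ m)) _
        (fun c => ih (fun m => cont (c ::ₘ m)) fun m => hb _)
      dsimp only
      omega

/-- The number of queries that suffices to compute a colour of level `j`. -/
def exploreCost (d : ℕ) : ℕ → ℕ
  | 0 => 0
  | j + 1 => d * (exploreCost d j + 1)

theorem numQueries_explore_le (O : Oracle n d) (j : ℕ) (v : Fin n) (cont : ℕ → QueryTree n d)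
    (b : ℕ) (hb : ∀ c, (cont c).numQueries O ≤ b) :
    (explore j v cont).numQueries O ≤ exploreCost d j + b := by
  induction j generalizing v cont b with
  | zero => simpa [explore, exploreCost] using hb 0
  | succ j ih =>
    have := numQueries_queryNbrs_le ih v (List.finRange d) (fun m => cont (Encodable.encode m)) b
      fun m => hb _
    simpa [explore, exploreCost] using this

/-- Compute the colours of level `k` of the vertices in a list and decide by their multiset. -/
def sampleTree (k : ℕ) : List (Fin n) → (Multiset ℕ → Bool) → QueryTree n d
  | [], D => .answer (D 0)
  | v :: l, D => explore k v fun c => sampleTree k l fun m => D (c ::ₘ m)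

theorem run_sampleTree (O : Oracle n d) (k : ℕ) (l : List (Fin n)) (D : Multiset ℕ → Bool) :
    (sampleTree k l D).run O = D (l.map (oracleColor O k) : List ℕ) := by
  induction l generalizing D with
  | nil => rfl
  | cons v l ih => rw [sampleTree, run_explore, ih, List.map_cons, Multiset.cons_coe]

theorem numQueries_sampleTree_le (O : Oracle n d) (k : ℕ) (l : List (Fin n))
    (D : Multiset ℕ → Bool) :
    (sampleTree k l D).numQueries O ≤ l.length * exploreCost d k := by
  induction l generalizing D with
  | nil => simp [sampleTree, QueryTree.numQueries]
  | cons v l ih =>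
    have := numQueries_explore_le O k v (fun c => sampleTree k l fun m => D (c ::ₘ m)) _
      fun c => ih _
    rw [sampleTree, List.length_cons, Nat.add_mul]
    omega

/-- The list of `v` has as many filled places as `v` has neighbours, since the degree does not
exceed `d`; being injective with values among the neighbours, it lists all of them. -/
theorem Oracle.Represents.adj_iff {O : Oracle n d} {G : SimpleGraph (Fin n)} (h : O.Represents G)
    (hG : ∀ v, #(nbr G v) ≤ d) (v w : Fin n) : G.Adj v w ↔ ∃ i, O v i = some w := by
  refine ⟨fun hvw => ?_, fun ⟨i, hi⟩ => h.adj v i w hi⟩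
  set S : Finset (Fin d) := univ.filter fun i => (O v i).isSome with hS
  have hget : ∀ i ∈ S, O v i = some ((O v i).getD v) := by
    intro i hi
    obtain ⟨x, hx⟩ := Option.isSome_iff_exists.1 (mem_filter.1 hi).2
    simp [hx]
  have hcard : #S = #(nbr G v) := by
    have h1 : S = univ.filter fun i : Fin d => (i : ℕ) < #(nbr G v) := by
      ext i
      simp only [hS, mem_filter, mem_univ, true_and, h.isSome_iff, degree_eq_card_nbr]
    rw [h1, Fin.card_filter_val_lt, min_eq_right (hG v)]
  have himg : S.image (fun i => (O v i).getD v) = nbr G v := by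
    apply eq_of_subset_of_card_le
    · intro x hx
      obtain ⟨i, hi, rfl⟩ := mem_image.1 hx
      exact mem_nbr.2 (h.adj v i _ (hget i hi))
    · rw [card_image_of_injOn, hcard]
      intro i hi j hj hij
      dsimp only at hij
      exact h.inj v i j _ (hget i hi) (hij ▸ hget j hj)
  obtain ⟨i, hi, rfl⟩ := mem_image.1 (himg ▸ mem_nbr.2 hvw)
  exact ⟨i, hget i hi⟩

theorem Oracle.Represents.oracleColor_eq {O : Oracle n d} {G : SimpleGraph (Fin n)}
    (h : O.Represents G) (hG : ∀ v, #(nbr G v) ≤ d) (j : ℕ) (v : Fin n) :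
    oracleColor O j v = color G j v := by
  induction j generalizing v with
  | zero => rfl
  | succ j ih =>
    rw [oracleColor, color, funext ih, ← Multiset.map_coe]
    congr 2
    refine (Multiset.Nodup.ext ?_ (nbr G v).nodup).2 fun w => ?_
    · rw [Multiset.coe_nodup]
      exact (List.nodup_finRange d).filterMap fun i i' w hi hi' => h.inj v i i' w hi hi'
    · simp [h.adj_iff hG]

/-- Every function of the oracle is computed by querying all entries. -/
theorem exists_queryTree (Φ : Oracle n d → Bool) :
    ∃ T : QueryTree n d, ∀ O, T.run O = Φ O ∧ T.numQueries O ≤ n * d := by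
  have key : ∀ (l : List (Fin n × Fin d)) (Φ : Oracle n d → Bool),
      (∀ O O' : Oracle n d, (∀ e ∈ l, O e.1 e.2 = O' e.1 e.2) → Φ O = Φ O') →
      ∃ T : QueryTree n d, ∀ O, T.run O = Φ O ∧ T.numQueries O ≤ l.length := by
    intro l
    induction l with
    | nil =>
      intro Φ hΦ
      refine ⟨.answer (Φ fun _ _ => none), fun O => ⟨hΦ _ _ (by simp), ?_⟩⟩
      simp [QueryTree.numQueries]
    | cons e l ih =>
      intro Φ hΦ
      -- Hard-wiring the reply at `e` leaves a function that depends only on the entries in `l`.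
      let upd (O : Oracle n d) (w : Option (Fin n)) : Oracle n d := fun v i =>
        if (v, i) = e then w else O v i
      have hupd : ∀ w, ∃ T : QueryTree n d, ∀ O, T.run O = Φ (upd O w) ∧
          T.numQueries O ≤ l.length := by
        intro w
        refine ih _ fun O O' hO => hΦ _ _ fun e' he' => ?_
        simp only [upd]
        split_ifs with h
        · rfl
        · exact hO e' ((List.mem_cons.1 he').resolve_left h)
      choose T hT using hupd
      refine ⟨.query e.1 e.2 T, fun O => ⟨?_, ?_⟩⟩
      · rw [QueryTree.run, (hT _ O).1]
        congr 1
        funext v i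
        simp only [upd]
        split_ifs with h
        · rw [← h]
        · rfl
      · rw [QueryTree.numQueries, List.length_cons]
        exact Nat.add_le_add_right (hT _ O).2 1
  obtain ⟨T, hT⟩ := key (univ : Finset (Fin n × Fin d)).toList Φ fun O O' h => by
    congr 1
    funext v i
    exact h (v, i) (by simp)
  exact ⟨T, fun O => ⟨(hT O).1, by simpa using (hT O).2⟩⟩

end Queries

/-! ### Estimating colour frequencies from independent samples -/

section Sampling

/-- Variances of independent samples add: mixed terms vanish because `g` has mean zero, which is why
the first identity is carried through the induction. -/
theorem sum_sq_sum {X : Type} [Fintype X] {g : X → ℝ} (hg : ∑ x, g x = 0) (s : ℕ) :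
    ∑ ω : Fin s → X, ∑ i, g (ω i) = 0 ∧
    Fintype.card X * ∑ ω : Fin s → X, (∑ i, g (ω i)) ^ 2 =
      s * (Fintype.card X : ℝ) ^ s * ∑ x, g x ^ 2 := by
  induction s with
  | zero => simp
  | succ s ih =>
    have hcons : ∀ φ : (Fin (s + 1) → X) → ℝ,
        ∑ ω, φ ω = ∑ x : X, ∑ ω : Fin s → X, φ (Fin.cons x ω) := by
      intro φ
      rw [← (Fin.consEquiv fun _ : Fin (s + 1) => X).sum_comp, Fintype.sum_prod_type]
      rfl
    rw [hcons, hcons]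
    simp only [Fin.sum_univ_succ, Fin.cons_zero, Fin.cons_succ]
    constructor
    · simp only [sum_add_distrib, ih.1, sum_const, ← smul_sum, hg]
      simp
    · have h1 : ∀ x : X, ∑ ω : Fin s → X, (g x + ∑ i, g (ω i)) ^ 2 =
          (Fintype.card X : ℝ) ^ s * g x ^ 2 + ∑ ω : Fin s → X, (∑ i, g (ω i)) ^ 2 := by
        intro x
        have : ∀ ω : Fin s → X, (g x + ∑ i, g (ω i)) ^ 2 =
            g x ^ 2 + 2 * g x * ∑ i, g (ω i) + (∑ i, g (ω i)) ^ 2 := fun ω => by ring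
        simp only [this, sum_add_distrib, ← mul_sum, ih.1]
        simp
      simp only [h1, sum_add_distrib, ← mul_sum, sum_const, card_univ, nsmul_eq_mul]
      rw [mul_add, ih.2]
      push_cast
      ring

/-- The empirical distribution of a bounded number of samples approximates the distribution of
the values of `c` with probability at least `2/3`. -/
theorem two_mul_card_le_card_good {n s : ℕ} (hn : 0 < n) (c : Fin n → ℕ) {K : Finset ℕ}
    {η : ℝ} (hη : 0 < η) (hs : 3 * #K < s * η ^ 2) :
    2 * Fintype.card (Fin s → Fin n) ≤ 3 * #(univ.filter fun ω : Fin s → Fin n =>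
      ∑ a ∈ K, |(#(univ.filter fun i => c (ω i) = a) : ℝ) / s -
        (#(univ.filter fun v => c v = a) : ℝ) / n| ≤ η) := by
  have hn' : (0 : ℝ) < n := by exact_mod_cast hn
  have hs' : (0 : ℝ) < s := by
    have h1 : (0 : ℝ) < s * η ^ 2 := lt_of_le_of_lt (by positivity) hs
    exact pos_of_mul_pos_left h1 (by positivity)
  set cnt : ℕ → ℝ := fun a => (#(univ.filter fun v => c v = a) : ℝ) with hcnt
  set est : (Fin s → Fin n) → ℕ → ℝ := fun ω a => (#(univ.filter fun i => c (ω i) = a) : ℝ)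
    with hest
  let g (a : ℕ) (x : Fin n) : ℝ := (if c x = a then 1 else 0) - cnt a / n
  have hg0 : ∀ a, ∑ x, g a x = 0 := by
    intro a
    simp only [g, sum_sub_distrib, sum_boole, sum_const, card_univ, Fintype.card_fin, nsmul_eq_mul]
    rw [mul_div_cancel₀ _ hn'.ne', sub_self]
  -- The variance of an indicator is at most its mean; summed over colours this keeps the total
  -- variance bound free of `#K`.
  have hg2 : ∀ a, ∑ x, g a x ^ 2 ≤ cnt a := by
    intro a
    have h1 : ∀ x, g a x ^ 2 = (if c x = a then 1 else 0) - cnt a / n * g a x -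
        cnt a / n * (if c x = a then 1 else 0) := by
      intro x
      simp only [g]
      split_ifs <;> ring
    simp only [h1, sum_sub_distrib, ← mul_sum, hg0, sum_boole]
    have : 0 ≤ cnt a / n * cnt a := by positivity
    have h2 : (#(univ.filter fun v => c v = a) : ℝ) = cnt a := rfl
    rw [h2]
    linarith
  have hcntn : ∑ a ∈ K, cnt a ≤ n := by
    have h1 : ∑ a ∈ K, #(univ.filter fun v => c v = a) ≤ #(univ : Finset (Fin n)) := by
      rw [← card_biUnion]
      · exact card_le_card (subset_univ _)
      · intro a _ b _ hab
        rw [Function.onFun, disjoint_left]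
        intro x hx hx'
        exact hab ((mem_filter.1 hx).2.symm.trans (mem_filter.1 hx').2)
    rw [card_univ, Fintype.card_fin] at h1
    simp only [hcnt]
    exact_mod_cast h1
  have hdev : ∀ ω a, est ω a / s - cnt a / n = (∑ i, g a (ω i)) / s := by
    intro ω a
    simp only [g, sum_sub_distrib, sum_boole, sum_const, card_univ, Fintype.card_fin, nsmul_eq_mul]
    rw [sub_div, mul_div_cancel_left₀ _ hs'.ne']
  have hvar : ∑ ω : Fin s → Fin n, ∑ a ∈ K, (∑ i, g a (ω i)) ^ 2 ≤ s * (n : ℝ) ^ s := by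
    rw [sum_comm]
    have h1 : n * ∑ a ∈ K, ∑ ω : Fin s → Fin n, (∑ i, g a (ω i)) ^ 2 ≤ n * (s * (n : ℝ) ^ s) := by
      rw [mul_sum]
      have : ∀ a ∈ K, n * ∑ ω : Fin s → Fin n, (∑ i, g a (ω i)) ^ 2 ≤ s * (n : ℝ) ^ s * cnt a := by
        intro a _
        have := (sum_sq_sum (hg0 a) s).2
        rw [Fintype.card_fin] at this
        rw [this]
        gcongr
        exact hg2 a
      refine (sum_le_sum this).trans ?_
      rw [← mul_sum, mul_comm]
      gcongr
    exact le_of_mul_le_mul_left h1 hn'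
  set good := univ.filter fun ω : Fin s → Fin n => ∑ a ∈ K, |est ω a / s - cnt a / n| ≤ η with hgood
  set bad := univ.filter fun ω : Fin s → Fin n => ¬ ∑ a ∈ K, |est ω a / s - cnt a / n| ≤ η with hbad
  have hsplit : #good + #bad = Fintype.card (Fin s → Fin n) :=
    card_filter_add_card_filter_not _
  have hcardΩ : (Fintype.card (Fin s → Fin n) : ℝ) = (n : ℝ) ^ s := by simp
  -- Cauchy–Schwarz over `K` passes from the `ℓ₁`-deviation to a sum of squares, to which Markov's
  -- inequality applies; `hs` then makes the bad samples at most a third.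
  have hbadle : ∀ ω ∈ bad, (s * η) ^ 2 ≤ #K * ∑ a ∈ K, (∑ i, g a (ω i)) ^ 2 := by
    intro ω hω
    have h1 := not_le.1 (mem_filter.1 hω).2
    have h2 : s * η ≤ ∑ a ∈ K, |∑ i, g a (ω i)| := by
      simp only [hdev, abs_div, Nat.abs_cast, ← sum_div] at h1
      rw [lt_div_iff₀ hs'] at h1
      linarith
    calc (s * η) ^ 2 ≤ (∑ a ∈ K, |∑ i, g a (ω i)|) ^ 2 := by gcongr
      _ ≤ #K * ∑ a ∈ K, |∑ i, g a (ω i)| ^ 2 := sq_sum_le_card_mul_sum_sq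
      _ = _ := by simp only [sq_abs]
  have hmarkov : #bad * (s * η) ^ 2 ≤ #K * (s * (n : ℝ) ^ s) := by
    calc (#bad : ℝ) * (s * η) ^ 2 = ∑ ω ∈ bad, (s * η) ^ 2 := by rw [sum_const, nsmul_eq_mul]
      _ ≤ ∑ ω ∈ bad, #K * ∑ a ∈ K, (∑ i, g a (ω i)) ^ 2 := sum_le_sum hbadle
      _ ≤ ∑ ω : Fin s → Fin n, #K * ∑ a ∈ K, (∑ i, g a (ω i)) ^ 2 :=
        sum_le_sum_of_subset_of_nonneg (subset_univ _) fun _ _ _ =>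
          mul_nonneg (Nat.cast_nonneg _) (sum_nonneg fun _ _ => sq_nonneg _)
      _ ≤ _ := by
        rw [← mul_sum]
        gcongr
  have h3 : 3 * (#bad : ℝ) ≤ (n : ℝ) ^ s := by
    have hpos : 0 < s * (s * η ^ 2) := by positivity
    refine le_of_mul_le_mul_right ?_ hpos
    calc 3 * (#bad : ℝ) * (s * (s * η ^ 2)) = 3 * (#bad * (s * η) ^ 2) := by ring
      _ ≤ 3 * (#K * (s * (n : ℝ) ^ s)) := by gcongr
      _ = (n : ℝ) ^ s * (s * (3 * #K)) := by ring
      _ ≤ _ := by gcongr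
  have h4 : 3 * #bad ≤ Fintype.card (Fin s → Fin n) := by
    rw [← hcardΩ] at h3
    exact_mod_cast h3
  change 2 * Fintype.card (Fin s → Fin n) ≤ 3 * #good
  omega

/-- The algorithm that runs a uniformly random member of a finite family of query trees. -/
def uniformAlgorithm {n d : ℕ} {Ω : Type} [Fintype Ω] [Nonempty Ω] (T : Ω → QueryTree n d) :
    RandomizedAlgorithm n d :=
  (PMF.uniformOfFintype Ω).map T

theorem two_thirds_le_prob {n d : ℕ} {Ω : Type} [Fintype Ω] [Nonempty Ω] {T : Ω → QueryTree n d}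
    {O : Oracle n d} {b : Bool} {S : Finset Ω} (hS : 2 * Fintype.card Ω ≤ 3 * #S)
    (hT : ∀ ω ∈ S, (T ω).run O = b) : 2 / 3 ≤ (uniformAlgorithm T).prob O b := by
  rw [RandomizedAlgorithm.prob, uniformAlgorithm, PMF.map_comp, ← PMF.toOuterMeasure_apply_singleton,
    PMF.toOuterMeasure_map_apply]
  have hsub : (S : Set Ω) ⊆ (QueryTree.run O ∘ T) ⁻¹' {b} := fun ω hω => hT ω hω
  refine le_trans ?_ (MeasureTheory.measure_mono hsub)
  rw [PMF.toOuterMeasure_uniformOfFintype_apply]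
  have hΩ : (Fintype.card Ω : ENNReal) ≠ 0 := by simp
  rw [ENNReal.le_div_iff_mul_le (.inl hΩ) (.inl (ENNReal.natCast_ne_top _))]
  rw [mul_comm, ← mul_div_assoc, ENNReal.div_le_iff_le_mul (by simp) (by simp)]
  simp only [coe_sort_coe, Fintype.card_coe]
  rw [mul_comm]
  rw [mul_comm (#S : ENNReal)]
  exact_mod_cast hS

end Sampling

/-! ### The testers for small and for large `n` -/

section Tester

variable {n d : ℕ}

theorem degreeBounded_iff {G : SimpleGraph (Fin n)} :
    DegreeBounded d G ↔ ∀ v, #(nbr G v) ≤ d := by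
  simp only [DegreeBounded, degree_eq_card_nbr]

theorem count_map_finRange {s : ℕ} (ω : Fin s → Fin n) (c : Fin n → ℕ) (a : ℕ) :
    Multiset.count a ((((List.finRange s).map ω).map c : List ℕ) : Multiset ℕ) =
      #(univ.filter fun i => c (ω i) = a) := by
  have h : ((((List.finRange s).map ω).map c : List ℕ) : Multiset ℕ) =
      (univ : Finset (Fin s)).val.map fun i => c (ω i) := by
    rw [List.map_map]
    rfl
  rw [h, Multiset.count_map]
  simp only [eq_comm (a := a)]
  rfl

theorem IsFar.notMem {ε : ℝ} (hε : 0 < ε) {P : GraphClass} {G : SimpleGraph (Fin n)}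
    (hd : DegreeBounded d G) (h : IsFar d ε P G) : G ∉ P.graphs n := by
  intro hG
  have := h G hd hG
  simp only [symmDiff_self, Set.bot_eq_empty, Set.ncard_empty, Nat.cast_zero] at this
  have h0 : 0 ≤ ε * d * n := by positivity
  linarith

/-- Any property can be tested by reading the whole graph. -/
theorem exists_exhaustive_tester (n d : ℕ) (P : GraphClass) {ε : ℝ} (hε : 0 < ε) :
    ∃ A : RandomizedAlgorithm n d,
      (∀ T ∈ A.support, ∀ O : Oracle n d, T.numQueries O ≤ n * d) ∧
      ∀ G : SimpleGraph (Fin n), DegreeBounded d G → ∀ O : Oracle n d, O.Represents G →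
        (G ∈ P.graphs n → 2 / 3 ≤ A.prob O true) ∧
        (IsFar d ε P G → 2 / 3 ≤ A.prob O false) := by
  obtain ⟨T, hT⟩ := exists_queryTree (n := n) (d := d) fun O =>
    decide (∃ G : SimpleGraph (Fin n), DegreeBounded d G ∧ O.Represents G ∧ G ∈ P.graphs n)
  refine ⟨PMF.pure T, fun T' hT' O => ?_, fun G hG O hO => ?_⟩
  · rw [PMF.support_pure, Set.mem_singleton_iff] at hT'
    rw [hT']
    exact (hT O).2
  -- The oracle determines the graph, so the existential in the decision refers to the input itself.
  · have huniq : ∀ H : SimpleGraph (Fin n), DegreeBounded d H → O.Represents H → H = G := by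
      intro H hH hOH
      ext v w
      rw [hOH.adj_iff (degreeBounded_iff.1 hH), hO.adj_iff (degreeBounded_iff.1 hG)]
    have hprob : ∀ b, T.run O = b → (2 / 3 : ENNReal) ≤ RandomizedAlgorithm.prob (PMF.pure T) O b := by
      rintro b rfl
      rw [RandomizedAlgorithm.prob, PMF.pure_map, PMF.pure_apply_self]
      exact ENNReal.div_le_of_le_mul (by norm_num)
    refine ⟨fun hGP => hprob _ ?_, fun hfar => hprob _ ?_⟩
    · rw [(hT O).1, decide_eq_true_iff]
      exact ⟨G, hG, hO, hGP⟩
    · rw [(hT O).1, decide_eq_false_iff_not]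
      rintro ⟨H, hH, hOH, hHP⟩
      rw [huniq H hH hOH] at hHP
      exact hfar.notMem hε hG hHP

/-- The tester that compares the colours of sampled vertices with the colour statistics of the
graphs in the property. -/
theorem exists_sampling_tester (hn : 0 < n) (𝔊 P : GraphClass) (ε : ℝ) (k s : ℕ) (K : Finset ℕ)
    {η : ℝ} (hη : 0 < η) (hs : 3 * #K < s * η ^ 2)
    (hclose : ∀ G ∈ 𝔊.graphs n, ∀ H ∈ 𝔊.graphs n, DegreeBounded d G → DegreeBounded d H →
      H ∈ P.graphs n → ∑ a ∈ K, |(colorCount G k a : ℝ) - colorCount H k a| ≤ 2 * η * n →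
      ¬ IsFar d ε P G) :
    ∃ A : RandomizedAlgorithm n d,
      (∀ T ∈ A.support, ∀ O : Oracle n d, T.numQueries O ≤ s * exploreCost d k) ∧
      ∀ G ∈ 𝔊.graphs n, DegreeBounded d G → ∀ O : Oracle n d, O.Represents G →
        (G ∈ P.graphs n → 2 / 3 ≤ A.prob O true) ∧
        (IsFar d ε P G → 2 / 3 ≤ A.prob O false) := by
  have hn' : (0 : ℝ) < n := by exact_mod_cast hn
  have : Nonempty (Fin n) := ⟨⟨0, hn⟩⟩
  -- Candidates are restricted to `𝔊`, where the girth is large enough for colours to control the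
  -- spectrum.
  let D (m : Multiset ℕ) : Bool := decide (∃ H ∈ 𝔊.graphs n, DegreeBounded d H ∧
    H ∈ P.graphs n ∧ ∑ a ∈ K, |(m.count a : ℝ) / s - (colorCount H k a : ℝ) / n| ≤ η)
  let T (ω : Fin s → Fin n) : QueryTree n d := sampleTree k ((List.finRange s).map ω) D
  refine ⟨uniformAlgorithm T, fun t ht O => ?_, fun G hG hGd O hO => ?_⟩
  · obtain ⟨ω, -, rfl⟩ := (PMF.mem_support_map_iff _ _ _).1 ht
    simpa [T] using numQueries_sampleTree_le O k ((List.finRange s).map ω) D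
  · have hrun : ∀ ω, (T ω).run O = decide (∃ H ∈ 𝔊.graphs n, DegreeBounded d H ∧
        H ∈ P.graphs n ∧ ∑ a ∈ K, |(#(univ.filter fun i => color G k (ω i) = a) : ℝ) / s -
          (colorCount H k a : ℝ) / n| ≤ η) := by
      intro ω
      simp only [T, run_sampleTree, D, funext (hO.oracleColor_eq (degreeBounded_iff.1 hGd) k),
        count_map_finRange]
    have hgood := two_mul_card_le_card_good hn (color G k) hη hs
    refine ⟨fun hGP => two_thirds_le_prob hgood fun ω hω => ?_,
      fun hfar => two_thirds_le_prob hgood fun ω hω => ?_⟩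
    · rw [hrun, decide_eq_true_iff]
      exact ⟨G, hG, hGd, hGP, (mem_filter.1 hω).2⟩
    · rw [hrun, decide_eq_false_iff_not]
      rintro ⟨H, hH, hHd, hHP, hdist⟩
      refine hclose G hG H hH hGd hHd hHP ?_ hfar
      have h1 : ∑ a ∈ K, |(colorCount G k a : ℝ) / n - (colorCount H k a : ℝ) / n| ≤ η + η := by
        refine le_trans ?_ (add_le_add (mem_filter.1 hω).2 hdist)
        rw [← sum_add_distrib]
        refine sum_le_sum fun a _ => ?_
        rw [abs_sub_comm ((#(univ.filter fun i => color G k (ω i) = a) : ℝ) / s)]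
        exact abs_sub_le _ _ _
      simp only [← sub_div, abs_div, Nat.abs_cast, ← sum_div] at h1
      rw [div_le_iff₀ hn'] at h1
      linarith

end Tester

theorem testableOn_of_robustlySpectral (d : ℕ) {𝔊 : GraphClass} (h𝔊 : 𝔊.HighGirth)
    {δ : ℝ} (hδ : 0 < δ) {P : GraphClass} (hP : RobustlySpectral d allGraphs δ P) :
    TestableOn d 𝔊 P := by
  suffices h : ∀ ε : ℝ, ∃ q : ℕ, 0 < ε → ∀ n : ℕ, ∃ A : RandomizedAlgorithm n d,
      (∀ T ∈ A.support, ∀ O : Oracle n d, T.numQueries O ≤ q) ∧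
      ∀ G ∈ 𝔊.graphs n, DegreeBounded d G → ∀ O : Oracle n d, O.Represents G →
        (G ∈ P.graphs n → 2 / 3 ≤ A.prob O true) ∧
        (IsFar d ε P G → 2 / 3 ≤ A.prob O false) by
    choose q hq using h
    exact ⟨q, hq⟩
  intro ε
  by_cases hε : 0 < ε
  swap
  · exact ⟨0, fun h => absurd h hε⟩
  obtain ⟨g, hg, h𝔊g⟩ := h𝔊
  obtain ⟨γ, L₀, n₀, hγ, hn₀, hedit⟩ := exists_close (d := d) hδ hε
  obtain ⟨L, η, hL, hη, hspec⟩ := exists_spectrum_close_of_colorCount d L₀ hγ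
  obtain ⟨K, hK⟩ := exists_finset_color d (L + 1)
  obtain ⟨n₁, hn₁⟩ := Filter.eventually_atTop.1 (hg.eventually_ge_atTop (L + 1))
  -- The precision is `η / 2` because the sample is compared with both `G` and the candidate `H`.
  obtain ⟨s, hs⟩ := exists_nat_gt (3 * #K / (η / 2) ^ 2)
  rw [div_lt_iff₀ (by positivity)] at hs
  -- The first summand pays for reading the whole graph when `n` is too small for the editing or the
  -- girth bound, the second for sampling.
  refine ⟨max n₀ n₁ * d + s * exploreCost d (L + 1), fun _ n => ?_⟩
  rcases lt_or_ge n (max n₀ n₁) with hn | hn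
  · obtain ⟨A, hA, hA'⟩ := exists_exhaustive_tester n d P hε
    refine ⟨A, fun T hT O => (hA T hT O).trans ?_, fun G _ => hA' G⟩
    exact (Nat.mul_le_mul_right d hn.le).trans (Nat.le_add_right _ _)
  · have hgirth : ∀ G ∈ 𝔊.graphs n, (L : ℕ∞) < G.egirth := fun G hG => by
      refine lt_of_lt_of_le ?_ (h𝔊g n G hG)
      exact_mod_cast hn₁ n ((le_max_right _ _).trans hn)
    have hn0 : n₀ ≤ n := (le_max_left _ _).trans hn
    have hclose : ∀ G ∈ 𝔊.graphs n, ∀ H ∈ 𝔊.graphs n, DegreeBounded d G → DegreeBounded d H →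
        H ∈ P.graphs n → ∑ a ∈ K, |(colorCount G (L + 1) a : ℝ) - colorCount H (L + 1) a| ≤
          2 * (η / 2) * n → ¬ IsFar d ε P G := by
      intro G hG H hH hGd hHd hHP hcount hfar
      obtain ⟨S, hS, hSP⟩ := hP n
      obtain ⟨-, -, x, hxS, hx⟩ := (hSP H).1 hHP
      -- Neither `X` nor the edited graph `G'` need lie in `𝔊`; large girth is used only for `G` and
      -- `H`.
      obtain ⟨X, -, hXd, rfl⟩ := hS hxS
      rw [degreeBounded_iff] at hGd hHd hXd
      have hGH := hspec n G H K hGd hHd (hgirth G hG) (hgirth H hH) (hK n G hGd) (hK n H hHd)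
        (hcount.trans_eq (by ring))
      have hGX : ∑ i, |graphSpectrum G i - graphSpectrum X i| ≤ (δ + γ) * n := by
        calc _ ≤ ∑ i, (|graphSpectrum G i - graphSpectrum H i| +
              |graphSpectrum H i - graphSpectrum X i|) :=
              sum_le_sum fun i _ => abs_sub_le _ _ _
          _ ≤ γ * n + δ * n := by
              rw [sum_add_distrib]
              exact add_le_add hGH hx
          _ = _ := by ring
      have hL₀ : (L₀ : ℕ∞) < G.egirth :=
        lt_of_le_of_lt (by exact_mod_cast hL) (hgirth G hG)
      obtain ⟨G', hG'd, hsymm, hG'X⟩ := hedit n G X hn0 hGd hL₀ hXd hGX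
      rw [← degreeBounded_iff] at hG'd
      have hG'P : G' ∈ P.graphs n := (hSP G').2 ⟨Set.mem_univ _, hG'd, _, hxS, hG'X⟩
      exact absurd (hfar G' hG'd hG'P) (not_lt.2 hsymm)
    obtain ⟨A, hA, hA'⟩ := exists_sampling_tester (hn₀.trans_le hn0) 𝔊 P ε (L + 1) s K
      (half_pos hη) hs hclose
    exact ⟨A, fun T hT O => (hA T hT O).trans (Nat.le_add_left _ _), hA'⟩

end SpectralTesting

end

theorem theorem4 (d : ℕ) (𝔊 : SpectralTesting.GraphClass) (h𝔊 : 𝔊.HighGirth)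
    (δ : ℝ) (hδ : 0 < δ) (P : SpectralTesting.GraphClass)
    (hP : SpectralTesting.RobustlySpectral d SpectralTesting.allGraphs δ P) :
    SpectralTesting.TestableOn d 𝔊 P :=
  SpectralTesting.testableOn_of_robustlySpectral d h𝔊 hδ hP
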